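/- Let $k$ be a field and let $N \to M$ be an extension of $k$-algebras (a unital $k$-algebra homomorphism, written as an inclusion) which is a symmetric Markov extension of index $\lambda^{-1}$. This means the following. \begin{itemize} \item There are an $N$-bimodule map $E: M\to N$ with $E(1)=1$, finite families $x_i, y_i\in M$ with $\sum_i E(mx_i)y_i = m = \sum_i x_iE(y_im)$ for all $m \in M$, and $0\neq\lambda\in k$ with $\sum_i x_iy_i=\lambda^{-1}1$. \item There is a linear trace $T: N\to k$ with $T(1)=1$ such that $T_0:=T\circ E$ is a trace on $M$. \item $E(um)=E(mu)$ for all $m\in M$ and all $u$ in the centralizer $U:=C_M(N)$. \end{itemize} Let $M_1=\mathrm{End}(M_N)$ be the basic construction, with $M\subset M_1$ by left multiplications, $e_1=E$ and $E_M: M_1\to M$ the $M$-bimodule map with $E_M(me_1m')=\lambda mm'$. Let $M_2\supset M_1$, $e_2$, $E_{M_1}: M_2\to M_1$ be obtained in the same way from $M_1/M$ and $E_M$, with the same $\lambda$. Put $T_1=T_0\circ E_M$, $T_2=T_1\circ E_{M_1}$ and $$V=C_{M_1}(M),\qquad A=C_{M_1}(N),\qquad B=C_{M_2}(M),$$ and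 write $T$ also for the restriction of $T_2$ to $C_{M_2}(N)$. Assume: \begin{enumerate} \item $\sum_i y_ix_i=\lambda^{-1}1$, or alternatively $T_1(\sum_i x_iue_1y_i)=T_0(u)$ for all $u\in U$; \item $U$ is Kanzaki separable (it has a symmetric separability element) and the trace $T_0|_U$ is non-degenerate; \item (depth 2) $E_M$ has finite dual bases contained in $A$, and $E_{M_1}$ has finite dual bases contained in $B$. \end{enumerate} Then $V$ has a unique symmetric separability element $f=f^{(1)}\otimes f^{(2)}$, the element $f^{(1)}T(f^{(2)})$ of $V$ is invertible, and with $w$ its inverse, the bilinear forms $$\langle a,b\rangle=\lambda^{-2}T(ae_2e_1wb),\qquad \langle a,b\rangle'=\lambda^{-2}T(be_1e_2wa)\qquad (a\in A,\ b\in B)$$ are non-degenerate. Moreover there are a linear map $S_B: B\to B$ with $\langle a,b\rangle=\langle a,S_B(b)\rangle'$ for all $a \in A$, $b \in B$, and linear maps $\Delta(a) = a_{(1)}\otimes a_{(2)}$, $\varepsilon$ and $S$ on $A$ with $$\langle a_{(1)},b\rangle\langle a_{(2)},b'\rangle=\langle a,bb'\rangle,\qquad \varepsilon(a)=\langle a,1\rangle,\qquad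 \langle S(a),b\rangle=\langle a,S_B(b)\rangle ,$$ such that the algebra $A$ with $\Delta,\varepsilon,S$ is a weak Hopf algebra. (By non-degeneracy $S_B,\Delta,\varepsilon,S$ are unique.) For this weak Hopf algebra the formula $$a\triangleright m=a_{(1)}\,m\,S(a_{(2)})\qquad (a\in A,\ m\in M),$$ computed in $M_1$, maps $A\otimes M$ into $M$, and it makes $M$ a left $A$-module algebra: $M$ is a (unital) left $A$-module under $\triangleright$, and for all $a\in A$, $m,m'\in M$ $$a\triangleright(mm')=(a_{(1)}\triangleright m)(a_{(2)}\triangleright m'),\qquad a\triangleright 1=\varepsilon_t(a)\triangleright 1,$$ where $\varepsilon_t(a)=(\varepsilon\otimes\mathrm{id})(\Delta(1)(a\otimes 1))$. Here a weak Hopf algebra is an algebra and coalgebra $H$ with a linear map $S: H\to H$ such that, for all $h,g,f\in H$: $\Delta(hg)=\Delta(h)\Delta(g)$; $\varepsilon(hgf)=\varepsilon(hg_{(1)})\varepsilon(g_{(2)}f)=\varepsilon(hg_{(2)})\varepsilon(g_{(1)}f)$; $(\Delta\otimes\mathrm{id})\Delta(1)=(\Delta(1)\otimes1)(1\otimes\Delta(1))=(1\otimes\Delta(1))(\Delta(1)\otimes1)$;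 $h_{(1)}S(h_{(2)})=(\varepsilon\otimes\mathrm{id})(\Delta(1)(h\otimes1))$; $S(h_{(1)})h_{(2)}=(\mathrm{id}\otimes\varepsilon)((1\otimes h)\Delta(1))$; $S(h_{(1)})h_{(2)}S(h_{(3)})=S(h)$. -/

import Mathlib

open scoped TensorProduct

noncomputable section

/-! ### Weak Hopf algebras and their module algebras -/

/-- A weak Hopf algebra over a field `k`: an algebra and a coalgebra `H` with the weak bialgebra
axioms and an antipode. -/
class WeakHopfAlgebra (k H : Type*) [Field k] [Ring H] [Algebra k H] extends Coalgebra k H where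
  /-- `Δ(hg) = Δ(h)Δ(g)` -/
  comul_mul (h g : H) : comul (h * g) = comul h * comul g
  /-- `ε(hgf) = ε(h g₁) ε(g₂ f)` -/
  counit_mul (h g f : H) : counit (h * g * f) =
    LinearMap.mul' k k (TensorProduct.map (counit ∘ₗ LinearMap.mulLeft k h)
      (counit ∘ₗ LinearMap.mulRight k f) (comul g))
  /-- `ε(hgf) = ε(h g₂) ε(g₁ f)` -/
  counit_mul_op (h g f : H) : counit (h * g * f) =
    LinearMap.mul' k k (TensorProduct.map (counit ∘ₗ LinearMap.mulRight k f)
      (counit ∘ₗ LinearMap.mulLeft k h) (comul g))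
  /-- `(Δ ⊗ id)Δ(1) = (Δ(1) ⊗ 1)(1 ⊗ Δ(1))` -/
  comul_one : TensorProduct.map comul (LinearMap.id : H →ₗ[k] H) (comul (1 : H)) =
    (comul (1 : H) ⊗ₜ[k] (1 : H)) *
      (TensorProduct.assoc k H H H).symm ((1 : H) ⊗ₜ[k] comul (1 : H))
  /-- `(Δ ⊗ id)Δ(1) = (1 ⊗ Δ(1))(Δ(1) ⊗ 1)` -/
  comul_one_op : TensorProduct.map comul (LinearMap.id : H →ₗ[k] H) (comul (1 : H)) =
    (TensorProduct.assoc k H H H).symm ((1 : H) ⊗ₜ[k] comul (1 : H)) *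
      (comul (1 : H) ⊗ₜ[k] (1 : H))
  /-- the antipode `S` -/
  antipode : H →ₗ[k] H
  /-- `h₁ S(h₂) = (ε ⊗ id)(Δ(1)(h ⊗ 1))` -/
  mul_antipode (h : H) : LinearMap.mul' k H (TensorProduct.map LinearMap.id antipode (comul h)) =
    TensorProduct.lid k H
      (TensorProduct.map counit LinearMap.id (comul (1 : H) * (h ⊗ₜ[k] (1 : H))))
  /-- `S(h₁) h₂ = (id ⊗ ε)((1 ⊗ h)Δ(1))` -/
  antipode_mul (h : H) : LinearMap.mul' k H (TensorProduct.map antipode LinearMap.id (comul h)) =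
    TensorProduct.rid k H
      (TensorProduct.map LinearMap.id counit (((1 : H) ⊗ₜ[k] h) * comul (1 : H)))
  /-- `S(h₁) h₂ S(h₃) = S(h)` -/
  antipode_mul_antipode (h : H) : LinearMap.mul' k H
    (TensorProduct.map
      (LinearMap.mul' k H ∘ₗ TensorProduct.map antipode LinearMap.id ∘ₗ comul)
      antipode (comul h)) = antipode h

namespace WeakHopfAlgebra

/-- The target counital map `ε_t(h) = (ε ⊗ id)(Δ(1)(h ⊗ 1))`. -/
def targetCounit (k : Type*) {H : Type*} [Field k] [Ring H] [Algebra k H] [WeakHopfAlgebra k H]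
    (h : H) : H :=
  TensorProduct.lid k H (TensorProduct.map Coalgebra.counit LinearMap.id
    (Coalgebra.comul (R := k) (1 : H) * (h ⊗ₜ[k] (1 : H))))

/-- A left `H`-module structure on the algebra `R`, given as an algebra homomorphism
`H → End_k(R)`, makes `R` a left `H`-module algebra:
`h · ab = (h₁ · a)(h₂ · b)` and `h · 1 = ε_t(h) · 1`. -/
structure IsModuleAlgebra {k H R : Type*} [Field k] [Ring H] [Algebra k H] [WeakHopfAlgebra k H]
    [Ring R] [Algebra k R] (act : H →ₐ[k] Module.End k R) : Prop where
  act_mul (h : H) (a b : R) : act h (a * b) =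
    LinearMap.mul' k R (TensorProduct.map (act.toLinearMap.flip a) (act.toLinearMap.flip b)
      (Coalgebra.comul (R := k) h))
  act_one (h : H) : act h 1 = act (targetCounit k h) 1

end WeakHopfAlgebra

/-! ### Symmetric separability elements -/

/-- `f ∈ R ⊗ R` is a symmetric separability element of the `k`-algebra `R`. -/
structure IsSymmSepElement {k R : Type*} [Field k] [Ring R] [Algebra k R]
    (f : R ⊗[k] R) : Prop where
  mul_eq_one : LinearMap.mul' k R f = 1
  casimir (r : R) : (r ⊗ₜ[k] (1 : R)) * f = f * ((1 : R) ⊗ₜ[k] r)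
  symm : TensorProduct.comm k R R f = f

/-- A Kanzaki separable algebra: one with a symmetric separability element. -/
def IsKanzakiSeparable (k R : Type*) [Field k] [Ring R] [Algebra k R] : Prop :=
  ∃ f : R ⊗[k] R, IsSymmSepElement f

/-! ### Frobenius extensions and the basic construction -/

/-- Frobenius coordinates of the extension `ι : N → M`: an `N`-bimodule map `E : M → N` with finite
dual bases `x`, `y`, i.e. `∑ E(m xᵢ) yᵢ = m = ∑ xᵢ E(yᵢ m)`. -/
structure FrobeniusSystem {k N M : Type*} [Field k] [Ring N] [Ring M] [Algebra k N] [Algebra k M]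
    (ι : N →ₐ[k] M) where
  E : M →ₗ[k] N
  E_left (n : N) (m : M) : E (ι n * m) = n * E m
  E_right (m : M) (n : N) : E (m * ι n) = E m * n
  card : ℕ
  x : Fin card → M
  y : Fin card → M
  dual_left (m : M) : ∑ i, ι (E (m * x i)) * y i = m
  dual_right (m : M) : ∑ i, x i * ι (E (y i * m)) = m

/-- The algebra `End(M_N)` of right `N`-linear endomorphisms of `M`. -/
def rightLinearEnd {k N M : Type*} [Field k] [Ring N] [Ring M] [Algebra k N] [Algebra k M]
    (ι : N →ₐ[k] M) : Subalgebra k (Module.End k M) where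
  carrier := {f | ∀ (m : M) (n : N), f (m * ι n) = f m * ι n}
  mul_mem' := by
    intro f g hf hg m n
    change f (g (m * ι n)) = f (g m) * ι n
    rw [hg m n, hf]
  add_mem' := by
    intro f g hf hg m n
    change f (m * ι n) + g (m * ι n) = (f m + g m) * ι n
    rw [hf m n, hg m n, add_mul]
  algebraMap_mem' := by
    intro r m n
    simp [Module.algebraMap_end_apply]

/-- The basic construction `M₁ = End(M_N)`. -/
def BasicConstruction {k N M : Type*} [Field k] [Ring N] [Ring M] [Algebra k N] [Algebra k M]
    (ι : N →ₐ[k] M) : Type _ := rightLinearEnd ι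

instance {k N M : Type*} [Field k] [Ring N] [Ring M] [Algebra k N] [Algebra k M]
    (ι : N →ₐ[k] M) : Ring (BasicConstruction ι) :=
  inferInstanceAs (Ring (rightLinearEnd ι).toSubring)

instance {k N M : Type*} [Field k] [Ring N] [Ring M] [Algebra k N] [Algebra k M]
    (ι : N →ₐ[k] M) : Algebra k (BasicConstruction ι) :=
  inferInstanceAs (Algebra k (rightLinearEnd ι))

/-- The inclusion `M₁ → End_k(M)`. -/
def BasicConstruction.toEnd {k N M : Type*} [Field k] [Ring N] [Ring M] [Algebra k N]
    [Algebra k M] (ι : N →ₐ[k] M) : BasicConstruction ι →ₐ[k] Module.End k M :=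
  (rightLinearEnd ι).val

/-- The embedding `M → M₁` by left multiplications. -/
def leftMul {k N M : Type*} [Field k] [Ring N] [Ring M] [Algebra k N] [Algebra k M]
    (ι : N →ₐ[k] M) : M →ₐ[k] BasicConstruction ι :=
  (Algebra.lmul k M).codRestrict (rightLinearEnd ι) (by
    intro a m n
    simp [mul_assoc])

theorem BasicConstruction.toEnd_injective {k N M : Type*} [Field k] [Ring N] [Ring M] [Algebra k N] [Algebra k M]
    (ι : N →ₐ[k] M) : Function.Injective (BasicConstruction.toEnd ι) :=
  Subtype.val_injective

theorem BasicConstruction.toEnd_mul {k N M : Type*} [Field k] [Ring N] [Ring M] [Algebra k N] [Algebra k M]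
    {ι : N →ₐ[k] M} (g : BasicConstruction ι) (m : M) (n : N) :
    BasicConstruction.toEnd ι g (m * ι n) = BasicConstruction.toEnd ι g m * ι n :=
  g.2 m n

theorem toEnd_leftMul {k N M : Type*} [Field k] [Ring N] [Ring M] [Algebra k N] [Algebra k M]
    (ι : N →ₐ[k] M) (m m' : M) : BasicConstruction.toEnd ι (leftMul ι m) m' = m * m' :=
  rfl

namespace FrobeniusSystem

/-- The Jones element `e₁ ∈ M₁`: the map `E`, seen as an endomorphism of `M`. -/
def jones {k N M : Type*} [Field k] [Ring N] [Ring M] [Algebra k N] [Algebra k M]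
    {ι : N →ₐ[k] M} (F : FrobeniusSystem ι) : BasicConstruction ι :=
  ⟨ι.toLinearMap ∘ₗ F.E, by
    intro m n
    simp [F.E_right]⟩

theorem toEnd_jones {k N M : Type*} [Field k] [Ring N] [Ring M] [Algebra k N] [Algebra k M]
    {ι : N →ₐ[k] M} (F : FrobeniusSystem ι) (m : M) :
    BasicConstruction.toEnd ι F.jones m = ι (F.E m) :=
  rfl

/-- The map `E_M : M₁ → M`, `E_M(g) = c ∑ g(xᵢ) yᵢ`; it is the linear map with
`E_M(m e₁ m') = c m m'`, see `expectation_mul_jones_mul`. -/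
def expectation {k N M : Type*} [Field k] [Ring N] [Ring M] [Algebra k N] [Algebra k M]
    {ι : N →ₐ[k] M} (F : FrobeniusSystem ι) (c : k) : BasicConstruction ι →ₗ[k] M where
  toFun g := c • ∑ i, BasicConstruction.toEnd ι g (F.x i) * F.y i
  map_add' g h := by simp [add_mul, Finset.sum_add_distrib]
  map_smul' r g := by simp [← Finset.smul_sum, smul_comm r c]

theorem expectation_apply {k N M : Type*} [Field k] [Ring N] [Ring M] [Algebra k N] [Algebra k M]
    {ι : N →ₐ[k] M} (F : FrobeniusSystem ι) (c : k) (g : BasicConstruction ι) :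
    F.expectation c g = c • ∑ i, BasicConstruction.toEnd ι g (F.x i) * F.y i :=
  rfl

theorem expectation_mul_jones_mul {k N M : Type*} [Field k] [Ring N] [Ring M] [Algebra k N] [Algebra k M]
    {ι : N →ₐ[k] M} (F : FrobeniusSystem ι) (c : k) (m m' : M) :
    F.expectation c (leftMul ι m * F.jones * leftMul ι m') = c • (m * m') := by
  simp only [expectation_apply, map_mul, Module.End.mul_apply, toEnd_leftMul, toEnd_jones,
    mul_assoc, ← Finset.mul_sum, F.dual_left]

theorem sum_apply_mul {k N M : Type*} [Field k] [Ring N] [Ring M] [Algebra k N] [Algebra k M]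
    {ι : N →ₐ[k] M} (F : FrobeniusSystem ι) (g : BasicConstruction ι) (m : M) :
    ∑ i, BasicConstruction.toEnd ι g (F.x i) * ι (F.E (F.y i * m)) =
      BasicConstruction.toEnd ι g m := by
  simp only [← BasicConstruction.toEnd_mul, ← map_sum, F.dual_right]

theorem sum_apply_mul_left {k N M : Type*} [Field k] [Ring N] [Ring M] [Algebra k N] [Algebra k M]
    {ι : N →ₐ[k] M} (F : FrobeniusSystem ι) (g : BasicConstruction ι) (m : M) :
    ∑ i, BasicConstruction.toEnd ι g (m * F.x i) * F.y i =
      (∑ i, BasicConstruction.toEnd ι g (F.x i) * F.y i) * m := by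
  simp_rw [← F.sum_apply_mul g (m * F.x _), Finset.sum_mul]
  rw [Finset.sum_comm]
  refine Finset.sum_congr rfl fun j _ => ?_
  simp only [mul_assoc, ← Finset.mul_sum]
  simp only [← mul_assoc (F.y j) m, F.dual_left]

/-- The extension `M ⊂ M₁` with `E_M` and the dual bases `c⁻¹ xᵢ e₁`, `e₁ yᵢ`. -/
def next {k N M : Type*} [Field k] [Ring N] [Ring M] [Algebra k N] [Algebra k M]
    {ι : N →ₐ[k] M} (F : FrobeniusSystem ι) (c : k) (hc : c ≠ 0) :
    FrobeniusSystem (leftMul ι) where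
  E := F.expectation c
  E_left m g := by
    simp only [expectation_apply, map_mul, Module.End.mul_apply, toEnd_leftMul, mul_assoc,
      ← Finset.mul_sum, mul_smul_comm]
  E_right g m := by
    simp only [expectation_apply, map_mul, Module.End.mul_apply, toEnd_leftMul,
      F.sum_apply_mul_left, smul_mul_assoc]
  card := F.card
  x i := c⁻¹ • (leftMul ι (F.x i) * F.jones)
  y i := F.jones * leftMul ι (F.y i)
  dual_left g := by
    have key (i : Fin F.card) :
        F.expectation c (g * (c⁻¹ • (leftMul ι (F.x i) * F.jones))) =
          BasicConstruction.toEnd ι g (F.x i) := by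
      have h1 : ∑ j, ι (F.E (F.x j)) * F.y j = 1 := by simpa using F.dual_left 1
      rw [mul_smul_comm, map_smul, expectation_apply, inv_smul_smul₀ hc]
      simp only [map_mul, Module.End.mul_apply, toEnd_leftMul, toEnd_jones,
        BasicConstruction.toEnd_mul, mul_assoc, ← Finset.mul_sum, h1, mul_one]
    apply BasicConstruction.toEnd_injective ι
    apply LinearMap.ext
    intro m
    simp only [key, map_sum, LinearMap.sum_apply, map_mul, Module.End.mul_apply, toEnd_leftMul,
      toEnd_jones, F.sum_apply_mul]
  dual_right g := by
    have key (i : Fin F.card) (m : M) :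
        F.E (F.expectation c (F.jones * leftMul ι (F.y i) * g) * m) =
          c • F.E (F.y i * BasicConstruction.toEnd ι g m) := by
      rw [expectation_apply, smul_mul_assoc, map_smul, Finset.sum_mul, map_sum]
      simp only [map_mul, Module.End.mul_apply, toEnd_leftMul, toEnd_jones, mul_assoc, F.E_left]
      simp only [← F.E_right, ← map_sum, mul_assoc, ← Finset.mul_sum, F.sum_apply_mul]
    apply BasicConstruction.toEnd_injective ι
    apply LinearMap.ext
    intro m
    simp only [map_sum, LinearMap.sum_apply, map_mul, Module.End.mul_apply, toEnd_leftMul,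
      toEnd_jones, map_smul, LinearMap.smul_apply, key, inv_smul_smul₀ hc,
      F.dual_right]

end FrobeniusSystem

/-! ### Symmetric Markov extensions and their Jones tower -/

/-- A symmetric Markov extension of index `lam⁻¹` with Markov trace `T`. -/
structure SymmetricMarkovExtension {k N M : Type*} [Field k] [Ring N] [Ring M]
    [Algebra k N] [Algebra k M] (ι : N →ₐ[k] M) extends FrobeniusSystem ι where
  E_one : E 1 = 1
  lam : k
  lam_ne_zero : lam ≠ 0
  sum_x_mul_y : ∑ i, x i * y i = lam⁻¹ • (1 : M)
  T : N →ₗ[k] k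
  T_one : T 1 = 1
  T_mul_comm (n n' : N) : T (n * n') = T (n' * n)
  T_E_mul_comm (m m' : M) : T (E (m * m')) = T (E (m' * m))
  E_symm (u : M) (hu : u ∈ Subalgebra.centralizer k (Set.range ι)) (m : M) :
    E (u * m) = E (m * u)

namespace SymmetricMarkovExtension

variable {k N M : Type*} [Field k] [Ring N] [Ring M] [Algebra k N] [Algebra k M]
  {ι : N →ₐ[k] M} (D : SymmetricMarkovExtension ι)

/-- `M₁`, as a type. -/
abbrev M₁ (_ : SymmetricMarkovExtension ι) : Type _ := BasicConstruction ι

/-- `M₂`, the basic construction of `M ⊂ M₁`, as a type. -/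
abbrev M₂ (_ : SymmetricMarkovExtension ι) : Type _ := BasicConstruction (leftMul ι)

/-- The embedding `M → M₁`. -/
abbrev incl₁ : M →ₐ[k] D.M₁ := leftMul ι

/-- The embedding `M₁ → M₂`. -/
abbrev incl₂ : D.M₁ →ₐ[k] D.M₂ := leftMul (leftMul ι)

/-- Frobenius coordinates of `M ⊂ M₁`; its map is `E_M` with `E_M(m e₁ m') = lam m m'`. -/
def frobenius₁ : FrobeniusSystem (leftMul ι) := D.toFrobeniusSystem.next D.lam D.lam_ne_zero

/-- Frobenius coordinates of `M₁ ⊂ M₂`; its map is `E_{M₁}` with `E_{M₁}(g e₂ h) = lam g h`. -/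
def frobenius₂ : FrobeniusSystem (leftMul (leftMul ι)) := D.frobenius₁.next D.lam D.lam_ne_zero

/-- The first Jones idempotent. -/
def e₁ : D.M₁ := D.toFrobeniusSystem.jones

/-- The second Jones idempotent. -/
def e₂ : D.M₂ := D.frobenius₁.jones

/-- `T₀ = T ∘ E` on `M`. -/
def T₀ : M →ₗ[k] k := D.T ∘ₗ D.E

/-- `T₁ = T₀ ∘ E_M` on `M₁`. -/
def T₁ : D.M₁ →ₗ[k] k := D.T₀ ∘ₗ D.frobenius₁.E

/-- `T₂ = T₁ ∘ E_{M₁}` on `M₂`. -/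
def T₂ : D.M₂ →ₗ[k] k := D.T₁ ∘ₗ D.frobenius₂.E

/-- `U = C_M(N)`. -/
def U (_ : SymmetricMarkovExtension ι) : Subalgebra k M :=
  Subalgebra.centralizer k (Set.range ι)

/-- `V = C_{M₁}(M)`. -/
def V : Subalgebra k D.M₁ := Subalgebra.centralizer k (Set.range D.incl₁)

/-- `A = C_{M₁}(N)`. -/
def A : Subalgebra k D.M₁ := Subalgebra.centralizer k (Set.range (D.incl₁.comp ι))

/-- `B = C_{M₂}(M)`. -/
def B : Subalgebra k D.M₂ := Subalgebra.centralizer k (Set.range (D.incl₂.comp D.incl₁))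

/-- The map `φ : U → V`, `φ(u) = ∑ xᵢ u e₁ yᵢ` (here defined on all of `M`). -/
def phi (u : M) : D.M₁ := ∑ i, D.incl₁ (D.x i * u) * D.e₁ * D.incl₁ (D.y i)

/-- The symmetric product condition `∑ yᵢ xᵢ = lam⁻¹`. -/
def SymmetricProduct : Prop := ∑ i, D.y i * D.x i = D.lam⁻¹ • (1 : M)

/-- The alternative to the symmetric product condition: `T₁ ∘ φ = T₀` on `U`. -/
def TracePreserving : Prop := ∀ u ∈ D.U, D.T₁ (D.phi u) = D.T₀ u

/-- Weak irreducibility: `U` is Kanzaki separable and the trace `T₀` is non-degenerate on `U`. -/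
def WeaklyIrreducible : Prop :=
  IsKanzakiSeparable k D.U ∧ ∀ u ∈ D.U, (∀ u' ∈ D.U, D.T₀ (u * u') = 0) → u = 0

/-- The map of the Frobenius system `F` of `Q → R` has (finite) dual bases in `C`. -/
def HasDualBasesIn {Q R : Type*} [Ring Q] [Ring R] [Algebra k Q] [Algebra k R]
    {j : Q →ₐ[k] R} (F : FrobeniusSystem j) (C : Subalgebra k R) : Prop :=
  ∃ (n : ℕ) (z w : Fin n → R), (∀ i, z i ∈ C) ∧ (∀ i, w i ∈ C) ∧
    (∀ r, ∑ i, j (F.E (r * z i)) * w i = r) ∧ (∀ r, ∑ i, z i * j (F.E (w i * r)) = r)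

/-- The (weak) depth 2 property: `E_M` has dual bases in `A` and `E_{M₁}` has dual bases
in `B`. -/
def DepthTwo : Prop := HasDualBasesIn D.frobenius₁ D.A ∧ HasDualBasesIn D.frobenius₂ D.B

/-- The trace on `V`, the restriction of `T₂`. -/
def traceV : D.V →ₗ[k] k := D.T₂ ∘ₗ D.incl₂.toLinearMap ∘ₗ D.V.val.toLinearMap

/-- The element `f⁽¹⁾ T(f⁽²⁾)` of `V`, for `f ∈ V ⊗ V`. -/
def slice (f : D.V ⊗[k] D.V) : D.V :=
  TensorProduct.rid k D.V (TensorProduct.map LinearMap.id D.traceV f)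

/-- `⟨a, b⟩ = lam⁻² T(a e₂ e₁ w b)` for `a ∈ A`, `b ∈ B`. -/
def pairing (w : D.V) : D.A →ₗ[k] D.B →ₗ[k] k :=
  LinearMap.mk₂ k (fun a b => (D.lam⁻¹) ^ 2 *
      D.T₂ (D.incl₂ a.1 * D.e₂ * D.incl₂ D.e₁ * D.incl₂ w.1 * b.1))
    (by intro a a' b; simp [add_mul, mul_add])
    (by intro c a b; simp [mul_left_comm])
    (by intro a b b'; simp [mul_add])
    (by intro c a b; simp [mul_left_comm])

/-- `⟨a, b⟩' = lam⁻² T(b e₁ e₂ w a)` for `a ∈ A`, `b ∈ B`. -/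
def pairing' (w : D.V) : D.A →ₗ[k] D.B →ₗ[k] k :=
  LinearMap.mk₂ k (fun a b => (D.lam⁻¹) ^ 2 *
      D.T₂ (b.1 * D.incl₂ D.e₁ * D.e₂ * D.incl₂ w.1 * D.incl₂ a.1))
    (by intro a a' b; simp [mul_add])
    (by intro c a b; simp [mul_left_comm])
    (by intro a b b'; simp [add_mul, mul_add])
    (by intro c a b; simp [mul_left_comm])

/-- The weak Hopf algebra structure on `A` is the one dual to the multiplication and the unit
of `B` and to the map `SB : B → B`, with respect to the pairing `⟨ , ⟩`. -/
structure IsDualStructure (w : D.V) (SB : D.B →ₗ[k] D.B) [WeakHopfAlgebra k D.A] : Prop where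
  /-- `⟨a₁, b⟩⟨a₂, b'⟩ = ⟨a, bb'⟩` -/
  comul (a : D.A) (b b' : D.B) :
    LinearMap.mul' k k (TensorProduct.map ((D.pairing w).flip b) ((D.pairing w).flip b')
      (Coalgebra.comul (R := k) a)) = D.pairing w a (b * b')
  /-- `ε(a) = ⟨a, 1⟩` -/
  counit (a : D.A) : Coalgebra.counit (R := k) a = D.pairing w a 1
  /-- `⟨S(a), b⟩ = ⟨a, S(b)⟩` -/
  antipode (a : D.A) (b : D.B) :
    D.pairing w (WeakHopfAlgebra.antipode (k := k) a) b = D.pairing w a (SB b)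

/-- The element `a₁ m S(a₂)` of `M₁`, for `a ∈ A` and `m ∈ M`. -/
def adjointAction [WeakHopfAlgebra k D.A] (a : D.A) (m : M) : D.M₁ :=
  LinearMap.mul' k D.M₁ (TensorProduct.map
    (LinearMap.mulRight k (D.incl₁ m) ∘ₗ D.A.val.toLinearMap)
    (D.A.val.toLinearMap ∘ₗ WeakHopfAlgebra.antipode (k := k))
    (Coalgebra.comul (R := k) a))

end SymmetricMarkovExtension

end

noncomputable section

/-! ### Symmetric separability elements and nondegenerate traces -/

/-! Evaluation identifies `A` with the `N`-bimodule endomorphisms of `M` (`ev`), and the adjoint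
action turns out to be this evaluation. Write l(u), r(u) for left and right multiplication by u ∈
`U`; r is an anti-isomorphism from `U` onto `V`. An element b of `B` is an `M`-bimodule endomorphism
of `M₁`, determined by c = b(e₁), which may be any element of `A` (`equivBA`).

In these terms ⟨a, b⟩ = T₀(∑ a(xᵢ) c(yᵢ) w) = λ⁻¹ T₁(a cᵗ l(w)), where t is the transpose for the
form E(mm') and w ∈ `U` is the inverse slice of the separability element ∑ pᵢ ⊗ qᵢ of `U`. Depth 2
combined with the dual bases of T₀ on `U` makes T₁ non-degenerate on `A` (`exists_dual_basis`);
hence both pairings are non-degenerate and t is an involution.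

The coproduct is characterized by a₁(m)a₂(m') = a(mm') together with Δ(1)Δ(a) = Δ(a), for Δ(1) = ∑
r(pᵢ) ⊗ l(qᵢ). It exists by depth 2 (`exists_isCoproduct`), is unique (`tensor_ext_ev₂`), and is
dual to the product of `B` (`IsCoproduct.pairing`). With z = w⁻¹ the antipode is S(a) = r(z) aᵗ
r(w), and the counital maps are ε_t(a) = l(a(1)) and ε_s(a) = r(aᵗ(w) z). The weak Hopf axioms then
become identities between maps on `M`. Finally, a₁ m S(a₂) sends m' to a₁(m) · (a₂S(a₃))(m') = a₁(m)
a₂(1) m' = a(m) m' (`adjointAction_eq`). -/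

theorem exists_tensor_eq_sum {k R : Type*} [Field k] [AddCommGroup R] [Module k R]
    (f : R ⊗[k] R) : ∃ (n : ℕ) (p q : Fin n → R), LinearIndependent k p ∧
      f = ∑ i, p i ⊗ₜ[k] q i := by
  obtain ⟨g, rfl⟩ := TensorProduct.eq_repr_basis_left (Module.Basis.ofVectorSpace k R) f
  let e := g.support.equivFin.symm
  refine ⟨g.support.card, fun i => Module.Basis.ofVectorSpace k R (e i), fun i => g (e i), ?_, ?_⟩
  · exact (Module.Basis.ofVectorSpace k R).linearIndependent.comp (fun i => (e i : _))
      (Subtype.val_injective.comp e.injective)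
  · rw [Finsupp.sum, ← Finset.sum_coe_sort,
      ← e.sum_comp (fun i : g.support => (Module.Basis.ofVectorSpace k R) i ⊗ₜ[k] g i)]

namespace IsSymmSepElement

variable {k R : Type*} [Field k] [Ring R] [Algebra k R] {n : ℕ} {p q : Fin n → R}

theorem sum_apply_mul_left {X : Type*} [AddCommGroup X] [Module k X]
    (hf : IsSymmSepElement (∑ i, p i ⊗ₜ[k] q i)) (g : R →ₗ[k] R →ₗ[k] X) (r : R) :
    ∑ i, g (r * p i) (q i) = ∑ i, g (p i) (q i * r) := by
  have h := congrArg (TensorProduct.lift g) (hf.casimir r)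
  simpa [Finset.mul_sum, Finset.sum_mul] using h

theorem sum_apply_swap {X : Type*} [AddCommGroup X] [Module k X]
    (hf : IsSymmSepElement (∑ i, p i ⊗ₜ[k] q i)) (g : R →ₗ[k] R →ₗ[k] X) :
    ∑ i, g (q i) (p i) = ∑ i, g (p i) (q i) := by
  have h := congrArg (TensorProduct.lift g) hf.symm
  simpa using h

theorem sum_apply_mul_right {X : Type*} [AddCommGroup X] [Module k X]
    (hf : IsSymmSepElement (∑ i, p i ⊗ₜ[k] q i)) (g : R →ₗ[k] R →ₗ[k] X) (r : R) :
    ∑ i, g (p i * r) (q i) = ∑ i, g (p i) (r * q i) := by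
  have h1 := hf.sum_apply_swap (g.flip.compl₂ (LinearMap.mulRight k r))
  have h2 := hf.sum_apply_swap (g.flip.comp (LinearMap.mulLeft k r))
  have h3 := hf.sum_apply_mul_left g.flip r
  simp only [LinearMap.compl₂_apply, LinearMap.flip_apply, LinearMap.mulRight_apply,
    LinearMap.comp_apply, LinearMap.mulLeft_apply] at h1 h2 h3
  rw [h1, ← h3, ← h2]

theorem sum_mul (hf : IsSymmSepElement (∑ i, p i ⊗ₜ[k] q i)) : ∑ i, p i * q i = 1 := by
  simpa using hf.mul_eq_one

theorem sum_mul_swap (hf : IsSymmSepElement (∑ i, p i ⊗ₜ[k] q i)) : ∑ i, q i * p i = 1 := by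
  rw [← hf.sum_mul]
  exact hf.sum_apply_swap (LinearMap.mul k R)

variable {τ : R →ₗ[k] k}

theorem sum_smul_mul (hf : IsSymmSepElement (∑ i, p i ⊗ₜ[k] q i)) (r : R) :
    ∑ i, τ (q i * r) • p i = r * ∑ i, τ (q i) • p i := by
  have h := hf.sum_apply_mul_left ((LinearMap.lsmul k R).flip.compl₂ τ) r
  simp only [LinearMap.compl₂_apply, LinearMap.flip_apply, LinearMap.lsmul_apply] at h
  rw [← h, Finset.mul_sum]
  simp

theorem mul_sum_smul_comm (hτ : ∀ r s, τ (r * s) = τ (s * r))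
    (hf : IsSymmSepElement (∑ i, p i ⊗ₜ[k] q i)) (r : R) :
    r * ∑ i, τ (q i) • p i = (∑ i, τ (q i) • p i) * r := by
  have h := hf.sum_apply_mul_right ((LinearMap.lsmul k R).flip.compl₂ τ) r
  simp only [LinearMap.compl₂_apply, LinearMap.flip_apply, LinearMap.lsmul_apply] at h
  rw [← hf.sum_smul_mul, Finset.sum_mul]
  simp only [smul_mul_assoc]
  rw [h]
  simp only [hτ r]

/-- The slice of a symmetric separability element by a nondegenerate trace is invertible, and the
inverse turns the element into a dual basis for the trace. -/
theorem exists_inverse (hτ : ∀ r s, τ (r * s) = τ (s * r))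
    (hnd : ∀ r, (∀ s, τ (r * s) = 0) → r = 0) (hp : LinearIndependent k p)
    (hf : IsSymmSepElement (∑ i, p i ⊗ₜ[k] q i)) :
    ∃ w : R, w * ∑ i, τ (q i) • p i = 1 ∧ (∀ r, w * r = r * w) ∧
      (∀ r, ∑ i, τ (q i * r * w) • p i = r) ∧ ∀ r, ∑ i, τ (r * p i * w) • q i = r := by
  set z := ∑ i, τ (q i) • p i with hz
  have hzc : ∀ r, r * z = z * r := hf.mul_sum_smul_comm hτ
  -- If rz = 0, then ∑ τ(qᵢ s r) pᵢ = s r z = 0. Independence of the pᵢ kills every coefficient,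
  -- non-degeneracy gives r qᵢ = 0, and so r = r ∑ qᵢ pᵢ = 0.
  have hinj : Function.Injective (LinearMap.mulRight k z) := by
    rw [← LinearMap.ker_eq_bot, LinearMap.ker_eq_bot']
    intro r hr
    have hr' : r * z = 0 := hr
    have h1 : ∀ s i, τ (q i * (s * r)) = 0 := by
      intro s
      refine Fintype.linearIndependent_iff.mp hp (fun i => τ (q i * (s * r))) ?_
      rw [hf.sum_smul_mul, ← hz, mul_assoc, hr', mul_zero]
    have h2 : ∀ i, r * q i = 0 := fun i => hnd _ fun s => by
      rw [mul_assoc, hτ, mul_assoc]; exact h1 s i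
    have h3 := congrArg (r * ·) hf.sum_mul_swap
    simp only [Finset.mul_sum, ← mul_assoc, h2, zero_mul, Finset.sum_const_zero, mul_one] at h3
    exact h3.symm
  -- Multiplication by z lands in the span of the pᵢ, so its injectivity forces R to be
  -- finite-dimensional, and then z is invertible.
  have hrange : ∀ r, LinearMap.mulRight k z r ∈ Submodule.span k (Set.range p) := by
    intro r
    rw [LinearMap.mulRight_apply, hz, ← hf.sum_smul_mul]
    exact Submodule.sum_mem _ fun i _ =>
      Submodule.smul_mem _ _ (Submodule.subset_span (Set.mem_range_self i))
  have : FiniteDimensional k (Submodule.span k (Set.range p)) :=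
    FiniteDimensional.span_of_finite k (Set.finite_range p)
  have : FiniteDimensional k R := by
    refine Module.Finite.of_injective ((LinearMap.mulRight k z).codRestrict _ hrange) ?_
    intro a b h
    exact hinj (congrArg Subtype.val h)
  obtain ⟨w, hw⟩ := LinearMap.surjective_of_injective hinj 1
  have hw1 : w * z = 1 := hw
  have hw2 : z * w = 1 := by rw [← hzc, hw1]
  have hwc : ∀ r, w * r = r * w := by
    intro r
    calc w * r = w * r * (z * w) := by rw [hw2, mul_one]
      _ = w * (r * z) * w := by simp only [mul_assoc]
      _ = (w * z) * r * w := by rw [hzc]; simp only [mul_assoc]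
      _ = r * w := by rw [hw1, one_mul]
  have hd : ∀ r, ∑ i, τ (q i * r * w) • p i = r := by
    intro r
    simp only [mul_assoc (q _)]
    rw [hf.sum_smul_mul, ← hz, mul_assoc, hw1, mul_one]
  refine ⟨w, hw1, hwc, hd, fun r => ?_⟩
  have h := hf.sum_apply_swap (X := R) ((LinearMap.lsmul k R).flip.compl₂
    (τ ∘ₗ LinearMap.mulLeft k r ∘ₗ LinearMap.mulRight k w))
  simp only [LinearMap.compl₂_apply, LinearMap.flip_apply, LinearMap.lsmul_apply,
    LinearMap.comp_apply, LinearMap.mulLeft_apply, LinearMap.mulRight_apply] at h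
  simp only [mul_assoc r]
  rw [h]
  conv_rhs => rw [← hd r]
  refine Finset.sum_congr rfl fun i _ => ?_
  rw [hτ r, mul_assoc, hwc, mul_assoc]

/-- Expanding the second legs of f in the dual basis supplied by f' gives f = (wz ⊗ 1) f', with w
from f' and z from f. Multiplying the legs together yields wz = 1. -/
theorem eq_of_nondegenerate (hτ : ∀ r s, τ (r * s) = τ (s * r))
    (hnd : ∀ r, (∀ s, τ (r * s) = 0) → r = 0) {f f' : R ⊗[k] R}
    (hf : IsSymmSepElement f) (hf' : IsSymmSepElement f') : f = f' := by
  obtain ⟨n, p, q, -, rfl⟩ := exists_tensor_eq_sum f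
  obtain ⟨n', p', q', hp', rfl⟩ := exists_tensor_eq_sum f'
  obtain ⟨w, -, hwc, hd, -⟩ := hf'.exists_inverse hτ hnd hp'
  set z := ∑ i, τ (q i) • p i with hz
  have hzc : ∀ r, r * z = z * r := hf.mul_sum_smul_comm hτ
  have key : ∑ i, p i ⊗ₜ[k] q i = ((w * z) ⊗ₜ[k] (1 : R)) * ∑ i, p' i ⊗ₜ[k] q' i := by
    calc ∑ i, p i ⊗ₜ[k] q i
        = ∑ i, p i ⊗ₜ[k] ∑ j, τ (q' j * q i * w) • p' j := by simp only [hd]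
      _ = ∑ j, (∑ i, τ (q i * (w * q' j)) • p i) ⊗ₜ[k] p' j := by
          simp only [TensorProduct.tmul_sum, TensorProduct.sum_tmul, TensorProduct.tmul_smul,
            TensorProduct.smul_tmul']
          rw [Finset.sum_comm]
          refine Finset.sum_congr rfl fun j _ => Finset.sum_congr rfl fun i _ => ?_
          rw [mul_assoc, hτ, mul_assoc]
      _ = ∑ j, (w * z * q' j) ⊗ₜ[k] p' j := by
          simp only [hf.sum_smul_mul, ← hz, mul_assoc, hzc]
      _ = ((w * z) ⊗ₜ[k] (1 : R)) * ∑ i, p' i ⊗ₜ[k] q' i := by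
          rw [← hf'.symm]
          simp [Finset.mul_sum]
  have h1 : w * z = 1 := by
    have h := congrArg (LinearMap.mul' k R) key
    rw [hf.mul_eq_one] at h
    simp only [Finset.mul_sum, Algebra.TensorProduct.tmul_mul_tmul, map_sum, LinearMap.mul'_apply,
      one_mul, mul_assoc] at h
    rw [← Finset.mul_sum, ← Finset.mul_sum, hf'.sum_mul, mul_one] at h
    exact h.symm
  rw [key, h1, ← Algebra.TensorProduct.one_def, one_mul]

/-- An anti-isomorphism maps symmetric separability elements to symmetric separability elements. -/
theorem map_antihom {R' : Type*} [Ring R'] [Algebra k R'] {f : R ⊗[k] R}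
    (hf : IsSymmSepElement f) (ρ : R →ₗ[k] R') (h1 : ρ 1 = 1)
    (hmul : ∀ r s, ρ (r * s) = ρ s * ρ r) (hsurj : Function.Surjective ρ) :
    IsSymmSepElement (TensorProduct.map ρ ρ f) := by
  obtain ⟨n, p, q, -, rfl⟩ := exists_tensor_eq_sum f
  refine ⟨?_, ?_, ?_⟩
  · simp only [map_sum, TensorProduct.map_tmul, LinearMap.mul'_apply, ← hmul]
    rw [← map_sum, hf.sum_mul_swap, h1]
  · intro r'
    obtain ⟨r, rfl⟩ := hsurj r'
    have h := hf.sum_apply_mul_right ((TensorProduct.mk k R' R').compl₁₂ ρ ρ) r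
    simpa [Finset.mul_sum, Finset.sum_mul, hmul] using h
  · have h := hf.sum_apply_swap ((TensorProduct.mk k R' R').compl₁₂ ρ ρ)
    simpa using h

end IsSymmSepElement

end

noncomputable section

/-! ### Traces and expectations in the Jones tower -/

namespace FrobeniusSystem

variable {k N M : Type*} [Field k] [Ring N] [Ring M] [Algebra k N] [Algebra k M]
  {ι : N →ₐ[k] M} (F : FrobeniusSystem ι)

/-- The tensor ∑ xᵢ ⊗ yᵢ over `N` commutes with `M`; one-sided `N`-linearity of φ and ψ is what lets
them be applied to its legs. -/
theorem sum_apply_casimir (φ ψ : M →ₗ[k] M) (hφ : ∀ m n, φ (m * ι n) = φ m * ι n)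
    (hψ : ∀ n m, ψ (ι n * m) = ι n * ψ m) (m : M) :
    ∑ i, φ (m * F.x i) * ψ (F.y i) = ∑ i, φ (F.x i) * ψ (F.y i * m) := by
  have h (i) : φ (m * F.x i) = ∑ j, φ (F.x j) * ι (F.E (F.y j * m * F.x i)) := by
    simp only [← hφ, ← map_sum, mul_assoc, F.dual_right]
  simp only [h, Finset.sum_mul]
  rw [Finset.sum_comm]
  refine Finset.sum_congr rfl fun j _ => ?_
  simp only [mul_assoc, ← hψ, ← Finset.mul_sum, ← map_sum]
  simp only [← mul_assoc (F.y j) m, F.dual_left]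

theorem expectation_mul_jones (c : k) (g : BasicConstruction ι) :
    F.expectation c (g * F.jones) = c • BasicConstruction.toEnd ι g 1 := by
  have h1 : ∑ j, ι (F.E (F.x j)) * F.y j = 1 := by simpa using F.dual_left 1
  rw [expectation_apply]
  congr 1
  have h2 (i) : BasicConstruction.toEnd ι (g * F.jones) (F.x i) =
      BasicConstruction.toEnd ι g 1 * ι (F.E (F.x i)) := by
    rw [← BasicConstruction.toEnd_mul, one_mul, map_mul, Module.End.mul_apply, toEnd_jones]
  simp only [h2, mul_assoc, ← Finset.mul_sum, h1, mul_one]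

theorem sum_leftMul_jones_leftMul (g : BasicConstruction ι) :
    ∑ i, leftMul ι (BasicConstruction.toEnd ι g (F.x i)) * F.jones * leftMul ι (F.y i) = g := by
  apply BasicConstruction.toEnd_injective ι
  ext m
  simp only [map_sum, LinearMap.sum_apply, map_mul, Module.End.mul_apply, toEnd_leftMul,
    toEnd_jones, F.sum_apply_mul]

theorem jones_mul_leftMul (n : N) :
    F.jones * leftMul ι (ι n) = leftMul ι (ι n) * F.jones := by
  apply BasicConstruction.toEnd_injective ι
  ext m
  simp [toEnd_leftMul, toEnd_jones, F.E_left]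

/-- The dual bases turn g into the matrix with entries E(yᵢ g(xⱼ)) in `N`. The functional is c times
the matrix trace followed by τ, so it inherits the trace property. -/
theorem trace_expectation_mul_comm (c : k) (τ : N →ₗ[k] k) (hτ : ∀ n n', τ (n * n') = τ (n' * n))
    (hE : ∀ m m', τ (F.E (m * m')) = τ (F.E (m' * m))) (g h : BasicConstruction ι) :
    τ (F.E (F.expectation c (g * h))) = τ (F.E (F.expectation c (h * g))) := by
  have key (g h : BasicConstruction ι) : τ (F.E (F.expectation c (g * h))) =
      c • ∑ i, ∑ j, τ (F.E (F.y i * BasicConstruction.toEnd ι g (F.x j)) *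
        F.E (F.y j * BasicConstruction.toEnd ι h (F.x i))) := by
    rw [expectation_apply, map_smul, map_smul, map_sum, map_sum]
    congr 1
    refine Finset.sum_congr rfl fun i _ => ?_
    have h1 : BasicConstruction.toEnd ι (g * h) (F.x i) = ∑ j, BasicConstruction.toEnd ι g (F.x j) *
        ι (F.E (F.y j * BasicConstruction.toEnd ι h (F.x i))) := by
      rw [map_mul, Module.End.mul_apply, F.sum_apply_mul]
    rw [hE, h1, Finset.mul_sum, map_sum, map_sum]
    simp only [← mul_assoc, F.E_right]
  rw [key, key, Finset.sum_comm]
  simp only [hτ]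

end FrobeniusSystem

namespace SymmetricMarkovExtension

variable {k N M : Type*} [Field k] [Ring N] [Ring M] [Algebra k N] [Algebra k M]
  {ι : N →ₐ[k] M} (D : SymmetricMarkovExtension ι)

theorem T₀_mul_comm (m m' : M) : D.T₀ (m * m') = D.T₀ (m' * m) := D.T_E_mul_comm m m'

theorem T₁_mul_comm (g h : D.M₁) : D.T₁ (g * h) = D.T₁ (h * g) :=
  D.toFrobeniusSystem.trace_expectation_mul_comm D.lam D.T D.T_mul_comm D.T_E_mul_comm g h

theorem T₂_mul_comm (g h : D.M₂) : D.T₂ (g * h) = D.T₂ (h * g) :=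
  D.frobenius₁.trace_expectation_mul_comm D.lam D.T₀ D.T₀_mul_comm D.T₁_mul_comm g h

theorem T₁_mul_e₁ (g : D.M₁) : D.T₁ (g * D.e₁) = D.lam * D.T₀ (BasicConstruction.toEnd ι g 1) := by
  have h := D.toFrobeniusSystem.expectation_mul_jones D.lam g
  have h' : D.T₁ (g * D.e₁) = D.T₀ (D.toFrobeniusSystem.expectation D.lam (g * D.e₁)) := rfl
  rw [h', e₁, h, map_smul, smul_eq_mul]

theorem T₂_mul_e₂ (g : D.M₂) :
    D.T₂ (g * D.e₂) = D.lam * D.T₁ (BasicConstruction.toEnd (leftMul ι) g 1) := by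
  have h := D.frobenius₁.expectation_mul_jones D.lam g
  have h' : D.T₂ (g * D.e₂) = D.T₁ (D.frobenius₁.expectation D.lam (g * D.e₂)) := rfl
  rw [h', e₂, h, map_smul, smul_eq_mul]

theorem T₁_apply (g : D.M₁) :
    D.T₁ g = D.lam * D.T₀ (∑ i, BasicConstruction.toEnd ι g (D.x i) * D.y i) := by
  have h' : D.T₁ g = D.T₀ (D.toFrobeniusSystem.expectation D.lam g) := rfl
  rw [h', FrobeniusSystem.expectation_apply, map_smul, smul_eq_mul]

theorem e₁_mul_e₁ : D.e₁ * D.e₁ = D.e₁ := by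
  apply BasicConstruction.toEnd_injective ι
  ext m
  simp only [e₁, map_mul, Module.End.mul_apply, FrobeniusSystem.toEnd_jones]
  have h (n : N) : D.E (ι n) = n := by rw [← mul_one (ι n), D.E_left, D.E_one, mul_one]
  rw [h]

theorem frobenius₂_E_incl₂ (g : D.M₁) : D.frobenius₂.E (D.incl₂ g) = g := by
  have h : D.frobenius₂.E (D.incl₂ g) = D.lam • ∑ i, g * (D.lam⁻¹ • (leftMul ι (D.x i) * D.e₁)) *
      (D.e₁ * leftMul ι (D.y i)) := rfl
  have h1 := D.toFrobeniusSystem.sum_leftMul_jones_leftMul 1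
  simp only [map_one, Module.End.one_apply] at h1
  rw [h]
  simp only [mul_smul_comm, smul_mul_assoc, ← Finset.smul_sum, smul_inv_smul₀ D.lam_ne_zero]
  conv_rhs => rw [← mul_one g, ← h1, Finset.mul_sum]
  refine Finset.sum_congr rfl fun i _ => ?_
  rw [← mul_assoc, mul_assoc g, mul_assoc (leftMul ι (D.x i)), e₁_mul_e₁, mul_assoc]
  rfl

theorem T₂_incl₂ (g : D.M₁) : D.T₂ (D.incl₂ g) = D.T₁ g := by
  rw [T₂, LinearMap.comp_apply, frobenius₂_E_incl₂]

/-- Cyclicity brings e₂, then e₁, to the far right. Each contributes a factor λ and leaves an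
evaluation at 1, so λ⁻² cancels. -/
theorem pairing_apply (w : D.V) (a : D.A) (b : D.B) : D.pairing w a b =
    D.T₀ (BasicConstruction.toEnd ι (BasicConstruction.toEnd (leftMul ι) b.1 a.1) 1 *
      BasicConstruction.toEnd ι w.1 1) := by
  have h1 : D.pairing w a b = (D.lam⁻¹) ^ 2 *
      D.T₂ (D.incl₂ a.1 * D.e₂ * D.incl₂ D.e₁ * D.incl₂ w.1 * b.1) := rfl
  have h2 : D.T₂ (D.incl₂ a.1 * D.e₂ * D.incl₂ D.e₁ * D.incl₂ w.1 * b.1) =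
      D.T₂ ((D.incl₂ (D.e₁ * w.1) * b.1 * D.incl₂ a.1) * D.e₂) := by
    have h := D.T₂_mul_comm (D.incl₂ a.1 * D.e₂) (D.incl₂ (D.e₁ * w.1) * b.1)
    have hm : D.incl₂ (D.e₁ * w.1) = D.incl₂ D.e₁ * D.incl₂ w.1 := map_mul _ _ _
    rw [hm] at h ⊢
    simpa only [mul_assoc] using h
  have h3 : BasicConstruction.toEnd (leftMul ι) (D.incl₂ (D.e₁ * w.1) * b.1 * D.incl₂ a.1) 1 =
      D.e₁ * (w.1 * BasicConstruction.toEnd (leftMul ι) b.1 a.1) := by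
    simp only [map_mul, Module.End.mul_apply, toEnd_leftMul, mul_one]
  have h4 (m : M) : BasicConstruction.toEnd ι w.1 m = m * BasicConstruction.toEnd ι w.1 1 := by
    have h := congrArg (fun g => BasicConstruction.toEnd ι g 1) (w.2 _ (Set.mem_range_self m))
    simpa [toEnd_leftMul] using h.symm
  rw [h1, h2, T₂_mul_e₂, h3, T₁_mul_comm, T₁_mul_e₁, map_mul, Module.End.mul_apply, h4]
  have := D.lam_ne_zero
  field_simp

theorem pairing'_apply (w : D.V) (a : D.A) (b : D.B) : D.pairing' w a b =
    D.lam⁻¹ * D.T₁ (w.1 * a.1 * BasicConstruction.toEnd (leftMul ι) b.1 D.e₁) := by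
  have h1 : D.pairing' w a b = (D.lam⁻¹) ^ 2 *
      D.T₂ (b.1 * D.incl₂ D.e₁ * D.e₂ * D.incl₂ w.1 * D.incl₂ a.1) := rfl
  have h2 : D.T₂ (b.1 * D.incl₂ D.e₁ * D.e₂ * D.incl₂ w.1 * D.incl₂ a.1) =
      D.T₂ ((D.incl₂ (w.1 * a.1) * (b.1 * D.incl₂ D.e₁)) * D.e₂) := by
    rw [mul_assoc, T₂_mul_comm, ← map_mul, mul_assoc (D.incl₂ _)]
  have h3 : BasicConstruction.toEnd (leftMul ι) (D.incl₂ (w.1 * a.1) * (b.1 * D.incl₂ D.e₁)) 1 =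
      w.1 * a.1 * BasicConstruction.toEnd (leftMul ι) b.1 D.e₁ := by
    simp only [map_mul, Module.End.mul_apply, toEnd_leftMul, mul_one, mul_assoc]
  rw [h1, h2, T₂_mul_e₂, h3]
  have := D.lam_ne_zero
  field_simp

end SymmetricMarkovExtension

end

noncomputable section

/-! ### The algebra `A` as the algebra of bimodule endomorphisms of `M` -/

namespace SymmetricMarkovExtension

variable {k N M : Type*} [Field k] [Ring N] [Ring M] [Algebra k N] [Algebra k M]
  {ι : N →ₐ[k] M} (D : SymmetricMarkovExtension ι)

/-- The action of `A` on `M` by evaluation. -/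
def ev : D.A →ₐ[k] Module.End k M := (BasicConstruction.toEnd ι).comp D.A.val

theorem ev_mul (a b : D.A) (m : M) : D.ev (a * b) m = D.ev a (D.ev b m) := rfl

theorem ev_mul_right (a : D.A) (m : M) (n : N) : D.ev a (m * ι n) = D.ev a m * ι n :=
  BasicConstruction.toEnd_mul a.1 m n

theorem ev_mul_left (a : D.A) (n : N) (m : M) : D.ev a (ι n * m) = ι n * D.ev a m := by
  have h := congrArg (fun g => BasicConstruction.toEnd ι g m) (a.2 _ (Set.mem_range_self n))
  exact h.symm

theorem ev_injective : Function.Injective D.ev :=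
  (BasicConstruction.toEnd_injective ι).comp Subtype.val_injective

variable {D} in
theorem A_ext {a b : D.A} (h : ∀ m, D.ev a m = D.ev b m) : a = b :=
  D.ev_injective (LinearMap.ext h)

/-- An `N`-bimodule endomorphism of `M`, as an element of `A`. -/
def ofEnd (φ : M →ₗ[k] M) (hr : ∀ m n, φ (m * ι n) = φ m * ι n)
    (hl : ∀ n m, φ (ι n * m) = ι n * φ m) : D.A :=
  ⟨⟨φ, hr⟩, by
    rintro _ ⟨n, rfl⟩
    apply BasicConstruction.toEnd_injective ι
    ext m
    exact (hl n m).symm⟩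

@[simp]
theorem ev_ofEnd (φ : M →ₗ[k] M) (hr : ∀ m n, φ (m * ι n) = φ m * ι n)
    (hl : ∀ n m, φ (ι n * m) = ι n * φ m) (m : M) : D.ev (D.ofEnd φ hr hl) m = φ m := rfl

theorem U_comm (u : D.U) (n : N) : ι n * u.1 = u.1 * ι n := u.2 _ (Set.mem_range_self n)

theorem mem_U_of_comm {m : M} (h : ∀ n, ι n * m = m * ι n) : m ∈ D.U := by
  rintro _ ⟨n, rfl⟩
  exact h n

/-- Left multiplication by elements of `U`. -/
def lmulU : D.U →ₐ[k] D.A where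
  toFun u := D.ofEnd (LinearMap.mulLeft k u.1) (by simp [mul_assoc]) (by
    intro n m
    simp only [LinearMap.mulLeft_apply, ← mul_assoc, D.U_comm])
  map_one' := A_ext fun m => one_mul m
  map_mul' u v := A_ext fun m => mul_assoc u.1 v.1 m
  map_zero' := A_ext fun m => zero_mul m
  map_add' u v := A_ext fun m => add_mul u.1 v.1 m
  commutes' r := A_ext fun m => (Algebra.smul_def r m).symm

/-- Right multiplication by elements of `U`. -/
def rmulU : D.U →ₗ[k] D.A where
  toFun u := D.ofEnd (LinearMap.mulRight k u.1) (by
    intro m n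
    simp only [LinearMap.mulRight_apply, mul_assoc, D.U_comm]) (by simp [mul_assoc])
  map_add' u v := A_ext fun m => mul_add m u.1 v.1
  map_smul' r u := A_ext fun m => mul_smul_comm r m u.1

@[simp]
theorem ev_lmulU (u : D.U) (m : M) : D.ev (D.lmulU u) m = u.1 * m := rfl

@[simp]
theorem ev_rmulU (u : D.U) (m : M) : D.ev (D.rmulU u) m = m * u.1 := rfl

theorem rmulU_one : D.rmulU 1 = 1 := A_ext fun m => mul_one m

theorem rmulU_mul (u v : D.U) : D.rmulU (u * v) = D.rmulU v * D.rmulU u :=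
  A_ext fun m => (mul_assoc m u.1 v.1).symm

theorem lmulU_mul_rmulU (u v : D.U) : D.lmulU u * D.rmulU v = D.rmulU v * D.lmulU u :=
  A_ext fun m => (mul_assoc u.1 m v.1).symm

/-- The action of `A` on `U`. -/
def evU (a : D.A) (u : D.U) : D.U :=
  ⟨D.ev a u.1, D.mem_U_of_comm fun n => by rw [← ev_mul_left, U_comm, ev_mul_right]⟩

/-- The Jones element in `A`. -/
def jonesA : D.A := ⟨D.e₁, by
  rintro _ ⟨n, rfl⟩
  exact (D.toFrobeniusSystem.jones_mul_leftMul n).symm⟩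

@[simp]
theorem ev_jonesA (m : M) : D.ev D.jonesA m = ι (D.E m) := rfl

theorem casimir (φ ψ : D.A) (m : M) :
    ∑ i, D.ev φ (m * D.x i) * D.ev ψ (D.y i) = ∑ i, D.ev φ (D.x i) * D.ev ψ (D.y i * m) :=
  D.toFrobeniusSystem.sum_apply_casimir (D.ev φ) (D.ev ψ) (D.ev_mul_right φ) (D.ev_mul_left ψ) m

theorem casimir_left (φ : D.A) (m : M) :
    ∑ i, D.ev φ (m * D.x i) * D.y i = ∑ i, D.ev φ (D.x i) * (D.y i * m) := by
  simpa using D.casimir φ 1 m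

theorem casimir_right (ψ : D.A) (m : M) :
    ∑ i, m * D.x i * D.ev ψ (D.y i) = ∑ i, D.x i * D.ev ψ (D.y i * m) := by
  simpa using D.casimir 1 ψ m

/-- The element `∑ a(xᵢ) c(yᵢ)` of `U`. -/
def bracket (a c : D.A) : D.U :=
  ⟨∑ i, D.ev a (D.x i) * D.ev c (D.y i), D.mem_U_of_comm fun n => by
    simp only [Finset.mul_sum, Finset.sum_mul, ← mul_assoc, ← ev_mul_left, casimir]
    simp only [ev_mul_right, mul_assoc]⟩

theorem E_injective_left {s s' : M} (h : ∀ m, D.E (m * s) = D.E (m * s')) : s = s' := by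
  rw [← D.dual_right s, ← D.dual_right s']
  simp only [h]

theorem E_injective_right {s s' : M} (h : ∀ m, D.E (s * m) = D.E (s' * m)) : s = s' := by
  rw [← D.dual_left s, ← D.dual_left s']
  simp only [h]

/-- The transpose with respect to the form `E(m m')`. -/
def transpose : D.A →ₗ[k] D.A where
  toFun a := D.ofEnd
    (∑ i, LinearMap.mulLeft k (D.x i) ∘ₗ ι.toLinearMap ∘ₗ D.E ∘ₗ LinearMap.mulLeft k (D.ev a (D.y i)))
    (by
      intro m n
      simp [Finset.sum_mul, ← mul_assoc, D.E_right])
    (by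
      intro n m
      have h := D.sum_apply_casimir LinearMap.id
        (ι.toLinearMap ∘ₗ D.E ∘ₗ LinearMap.mulRight k m ∘ₗ D.ev a) (by simp)
        (by intro n' m'; simp [ev_mul_left, mul_assoc, D.E_left]) (ι n)
      simp only [LinearMap.id_apply, LinearMap.comp_apply, LinearMap.mulRight_apply,
        AlgHom.toLinearMap_apply, ev_mul_right] at h
      simp only [LinearMap.sum_apply, LinearMap.comp_apply, LinearMap.mulLeft_apply,
        AlgHom.toLinearMap_apply, Finset.mul_sum, ← mul_assoc]
      exact h.symm)
  map_add' a b := A_ext fun m => by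
    simp [add_mul, mul_add, Finset.sum_add_distrib]
  map_smul' r a := A_ext fun m => by
    simp [Finset.smul_sum]

theorem ev_transpose (a : D.A) (m : M) :
    D.ev (D.transpose a) m = ∑ i, D.x i * ι (D.E (D.ev a (D.y i) * m)) := by
  simp [transpose]

theorem E_ev_mul (a : D.A) (m m' : M) :
    D.E (D.ev a m * m') = D.E (m * D.ev (D.transpose a) m') := by
  rw [ev_transpose, Finset.mul_sum, map_sum]
  simp only [← mul_assoc, D.E_right, ← D.E_left]
  rw [← map_sum, ← Finset.sum_mul]
  simp only [← ev_mul_left, ← map_sum, D.dual_left]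

variable {D} in
theorem transpose_eq {a b : D.A} (h : ∀ m m', D.E (D.ev a m * m') = D.E (m * D.ev b m')) :
    D.transpose a = b :=
  A_ext fun m' => D.E_injective_left fun m => by rw [← h, E_ev_mul]

theorem transpose_mul (a b : D.A) : D.transpose (a * b) = D.transpose b * D.transpose a :=
  transpose_eq fun m m' => by
    rw [ev_mul, ev_mul, E_ev_mul, E_ev_mul]

/-- The symmetry E(um) = E(mu) for u ∈ `U` enters here: it lets the transpose exchange left and
right multiplications. -/
theorem transpose_lmulU (u : D.U) : D.transpose (D.lmulU u) = D.rmulU u :=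
  transpose_eq fun m m' => by
    rw [ev_lmulU, ev_rmulU, mul_assoc, D.E_symm _ u.2, mul_assoc]

theorem transpose_rmulU (u : D.U) : D.transpose (D.rmulU u) = D.lmulU u :=
  transpose_eq fun m m' => by
    rw [ev_lmulU, ev_rmulU, mul_assoc]

theorem transpose_injective : Function.Injective D.transpose := fun a b h =>
  A_ext fun m => D.E_injective_right fun m' => by rw [E_ev_mul, h, ← E_ev_mul]

/-- The inverse of the transpose. -/
def transposeInv (a : D.A) : D.A := D.ofEnd
    (∑ i, LinearMap.mulRight k (D.y i) ∘ₗ ι.toLinearMap ∘ₗ D.E ∘ₗ LinearMap.mulRight k (D.ev a (D.x i)))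
    (by
      intro m n
      have h := D.sum_apply_casimir
        (ι.toLinearMap ∘ₗ D.E ∘ₗ LinearMap.mulLeft k m ∘ₗ D.ev a) LinearMap.id
        (by intro n' m'; simp [ev_mul_right, ← mul_assoc, D.E_right]) (by simp) (ι n)
      simp only [LinearMap.id_apply, LinearMap.comp_apply, LinearMap.mulLeft_apply,
        AlgHom.toLinearMap_apply, ev_mul_left] at h
      simp only [LinearMap.sum_apply, LinearMap.comp_apply, LinearMap.mulRight_apply,
        AlgHom.toLinearMap_apply, Finset.sum_mul, mul_assoc]
      exact h)
    (by
      intro n m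
      simp [Finset.mul_sum, mul_assoc, D.E_left])

theorem ev_transposeInv (a : D.A) (m : M) :
    D.ev (D.transposeInv a) m = ∑ i, ι (D.E (m * D.ev a (D.x i))) * D.y i := by
  simp [transposeInv]

theorem transpose_transposeInv (a : D.A) : D.transpose (D.transposeInv a) = a :=
  transpose_eq fun m m' => by
    rw [ev_transposeInv, Finset.sum_mul, map_sum]
    simp only [mul_assoc, D.E_left]
    simp only [← D.E_right, ← map_sum, mul_assoc, ← Finset.mul_sum, ← ev_mul_right, D.dual_right]

theorem T₀_ev_mul (a : D.A) (m m' : M) :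
    D.T₀ (D.ev a m * m') = D.T₀ (m * D.ev (D.transpose a) m') :=
  congrArg D.T (D.E_ev_mul a m m')

theorem T₁_coe (a : D.A) :
    D.T₁ a.1 = D.lam * D.T₀ (∑ i, D.ev a (D.x i) * D.y i) := D.T₁_apply a.1

theorem T₁_mul_comm_A (a b : D.A) : D.T₁ (a * b).1 = D.T₁ (b * a).1 := D.T₁_mul_comm a.1 b.1

/-- Since T₀ is a trace, the form T₀(mm') does not distinguish left from right transposes.
Non-degeneracy of T₁ later upgrades this to `transpose` being an involution. -/
theorem T₁_transpose_mul (a c : D.A) :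
    D.T₁ (D.transpose a * c).1 = D.T₁ (D.transposeInv a * c).1 := by
  rw [T₁_coe, T₁_coe, map_sum, map_sum]
  congr 1
  refine Finset.sum_congr rfl fun i _ => ?_
  simp only [map_mul, Module.End.mul_apply]
  rw [T₀_mul_comm, ← T₀_ev_mul, T₀_ev_mul D (D.transposeInv a), transpose_transposeInv,
    T₀_mul_comm]

/-- Both alternatives of the first hypothesis enter only through this formula: the left side is λ ∑
T₀(xᵢ u yᵢ), which is T₁(φ(u)), and also λ T₀(u ∑ yᵢxᵢ) by cyclicity. -/
theorem T₁_rmulU (h : D.SymmetricProduct ∨ D.TracePreserving) (u : D.U) :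
    D.T₁ (D.rmulU u).1 = D.T₀ u.1 := by
  rw [T₁_coe]
  simp only [ev_rmulU]
  rcases h with h | h
  · rw [map_sum]
    have h' : D.T₀ (u.1 * ∑ i, D.y i * D.x i) = ∑ i, D.T₀ (D.x i * u.1 * D.y i) := by
      rw [Finset.mul_sum, map_sum]
      refine Finset.sum_congr rfl fun i _ => ?_
      rw [mul_assoc, T₀_mul_comm D (D.x i), mul_assoc]
    rw [← h', h, mul_smul_comm, mul_one, map_smul, smul_eq_mul, mul_inv_cancel_left₀ D.lam_ne_zero]
  · rw [← h u.1 u.2, phi, map_sum, map_sum, Finset.mul_sum]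
    refine Finset.sum_congr rfl fun i _ => ?_
    have h' := D.toFrobeniusSystem.expectation_mul_jones_mul D.lam (D.x i * u.1) (D.y i)
    have h'' (g : D.M₁) : D.T₁ g = D.T₀ (D.toFrobeniusSystem.expectation D.lam g) := rfl
    rw [h'', e₁, h', map_smul, smul_eq_mul]

/-- Applying `T₁_rmulU` to ∑ a(xᵢ)yᵢ and to ∑ xᵢa(yᵢ) turns the two sides into double sums, both
equal to λ² T₀(∑ xⱼ a(yⱼxᵢ) yᵢ) by the Casimir property. -/
theorem T₁_transpose (h : D.SymmetricProduct ∨ D.TracePreserving) (a : D.A) :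
    D.T₁ (D.transpose a).1 = D.T₁ a.1 := by
  have h1 : D.T₁ a.1 = D.lam * D.T₁ (D.rmulU (D.bracket a 1)).1 := by
    rw [T₁_rmulU D h, T₁_coe]
    rfl
  have h2 : D.T₁ (D.transpose a).1 = D.lam * D.T₁ (D.rmulU (D.bracket 1 a)).1 := by
    rw [T₁_rmulU D h, T₁_coe]
    simp only [bracket, map_one, Module.End.one_apply, map_sum]
    congr 1
    refine Finset.sum_congr rfl fun i _ => ?_
    rw [T₀_mul_comm, ← T₀_ev_mul, T₀_mul_comm]
  rw [h1, h2, T₁_coe, T₁_coe]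
  congr 3
  simp only [ev_rmulU, bracket, map_one, Module.End.one_apply]
  calc ∑ i, D.x i * (∑ j, D.x j * D.ev a (D.y j)) * D.y i
      = ∑ i, ∑ j, D.x j * D.ev a (D.y j * D.x i) * D.y i := by
        refine Finset.sum_congr rfl fun i _ => ?_
        rw [← Finset.sum_mul, ← casimir_right, Finset.mul_sum]
        simp only [mul_assoc]
    _ = ∑ j, D.x j * ∑ i, D.ev a (D.y j * D.x i) * D.y i := by
        rw [Finset.sum_comm]
        simp only [Finset.mul_sum, mul_assoc]
    _ = ∑ j, D.x j * (∑ i, D.ev a (D.x i) * D.y i) * D.y j := by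
        refine Finset.sum_congr rfl fun j _ => ?_
        rw [casimir_left]
        simp only [Finset.mul_sum, Finset.sum_mul, mul_assoc]

/-! ### The algebra `B` -/

/-- The linear map `b ↦ b(e₁)` from `B` to `A`. -/
def toA : D.B →ₗ[k] D.A where
  toFun b := ⟨BasicConstruction.toEnd (leftMul ι) b.1 D.e₁, by
    rintro _ ⟨n, rfl⟩
    have h := congrArg (fun g => BasicConstruction.toEnd (leftMul ι) g D.e₁)
      (b.2 _ (Set.mem_range_self (ι n)))
    refine h.trans ?_
    rw [map_mul, Module.End.mul_apply]
    change BasicConstruction.toEnd (leftMul ι) b.1 (leftMul ι (ι n) * D.e₁) = _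
    rw [e₁, ← D.toFrobeniusSystem.jones_mul_leftMul n, BasicConstruction.toEnd_mul]
    rfl⟩
  map_add' b b' := rfl
  map_smul' r b := rfl

theorem toEnd_B_mul (b : D.B) (m : M) (g : D.M₁) :
    BasicConstruction.toEnd (leftMul ι) b.1 (leftMul ι m * g) =
      leftMul ι m * BasicConstruction.toEnd (leftMul ι) b.1 g := by
  have h := congrArg (fun h => BasicConstruction.toEnd (leftMul ι) h g)
    (b.2 _ (Set.mem_range_self m))
  exact h.symm

/-- b is `M`-linear on both sides and g = ∑ g(xᵢ) e₁ yᵢ, so only the value of b at e₁ matters. -/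
theorem toEnd_B (b : D.B) (g : D.M₁) : BasicConstruction.toEnd (leftMul ι) b.1 g =
    ∑ i, leftMul ι (BasicConstruction.toEnd ι g (D.x i)) * (D.toA b).1 * leftMul ι (D.y i) := by
  conv_lhs => rw [← D.toFrobeniusSystem.sum_leftMul_jones_leftMul g]
  simp only [map_sum, BasicConstruction.toEnd_mul, toEnd_B_mul]
  rfl

theorem toEnd_toEnd_B (b : D.B) (g : D.M₁) (m : M) :
    BasicConstruction.toEnd ι (BasicConstruction.toEnd (leftMul ι) b.1 g) m =
      ∑ i, BasicConstruction.toEnd ι g (D.x i) * D.ev (D.toA b) (D.y i * m) := by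
  simp only [toEnd_B, map_sum, LinearMap.sum_apply, map_mul, Module.End.mul_apply, toEnd_leftMul]
  rfl

theorem toA_injective : Function.Injective D.toA := fun b b' h => by
  apply Subtype.ext
  apply BasicConstruction.toEnd_injective
  ext g : 1
  rw [toEnd_B, toEnd_B, h]

/-- The element of `B` with a given value at the Jones element. -/
def ofJones (a : D.A) : D.B :=
  ⟨⟨∑ i, LinearMap.mulRight k (a.1 * leftMul ι (D.y i)) ∘ₗ (leftMul ι).toLinearMap ∘ₗ
      LinearMap.applyₗ (D.x i) ∘ₗ (BasicConstruction.toEnd ι).toLinearMap, by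
    intro g m
    apply BasicConstruction.toEnd_injective ι
    ext m'
    have h := D.sum_apply_casimir (BasicConstruction.toEnd ι g)
      (LinearMap.mulRight k 1 ∘ₗ D.ev a ∘ₗ LinearMap.mulRight k m')
      (BasicConstruction.toEnd_mul g)
      (by intro n s; simp [mul_assoc, ev_mul_left]) m
    simpa [toEnd_leftMul, Finset.sum_mul, ev, mul_assoc] using h⟩, by
    rintro _ ⟨m, rfl⟩
    apply BasicConstruction.toEnd_injective
    ext g : 1
    change leftMul ι m * (∑ i : Fin D.card, _ : _ →ₗ[k] _) g =
      (∑ i : Fin D.card, _ : _ →ₗ[k] _) (leftMul ι m * g)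
    simp [Finset.mul_sum, toEnd_leftMul, mul_assoc]⟩

theorem toA_ofJones (a : D.A) : D.toA (D.ofJones a) = a := by
  apply A_ext
  intro m
  change BasicConstruction.toEnd ι ((∑ i : Fin D.card, _ : _ →ₗ[k] _) D.e₁) m = _
  simp only [LinearMap.sum_apply, LinearMap.comp_apply, LinearMap.mulRight_apply,
    AlgHom.toLinearMap_apply, LinearMap.applyₗ_apply_apply, map_sum, map_mul, Module.End.mul_apply,
    toEnd_leftMul, e₁, FrobeniusSystem.toEnd_jones]
  change ∑ i, ι (D.E (D.x i)) * D.ev a (D.y i * m) = _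
  have h := D.dual_left 1
  simp only [one_mul] at h
  simp only [← ev_mul_left, ← map_sum, ← mul_assoc, ← Finset.sum_mul, h, one_mul]

/-- The linear isomorphism `b ↦ b(e₁)` from `B` to `A`. -/
def equivBA : D.B ≃ₗ[k] D.A :=
  LinearEquiv.ofBijective D.toA ⟨D.toA_injective, fun a => ⟨D.ofJones a, D.toA_ofJones a⟩⟩

theorem toA_equivBA_symm (a : D.A) : D.toA (D.equivBA.symm a) = a :=
  D.equivBA.apply_symm_apply a

end SymmetricMarkovExtension

end

noncomputable section

/-! ### Coalgebras dual to algebras -/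

section DualCoalgebra

variable {k A B κ : Type*} [Field k] [AddCommGroup A] [Module k A] [Ring B] [Algebra k B]
  [Fintype κ] {P : A →ₗ[k] B →ₗ[k] k} {β : κ → B} {d : κ → A}

/-- The dual bases rebuild t as ∑ dᵢ ⊗ (⟨·, βᵢ⟩ ⊗ id)(t). -/
theorem tensor_ext_left (hd : ∀ a, ∑ i, P a (β i) • d i = a) {X : Type*} [AddCommGroup X]
    [Module k X] {t t' : A ⊗[k] X} (h : ∀ b, TensorProduct.lid k X
      (TensorProduct.map (P.flip b) LinearMap.id t) = TensorProduct.lid k X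
      (TensorProduct.map (P.flip b) LinearMap.id t')) : t = t' := by
  have key (t : A ⊗[k] X) : ∑ i, d i ⊗ₜ[k] TensorProduct.lid k X
      (TensorProduct.map (P.flip (β i)) LinearMap.id t) = t := by
    induction t using TensorProduct.induction_on with
    | zero => simp
    | tmul a x =>
      simp only [TensorProduct.map_tmul, TensorProduct.lid_tmul, LinearMap.flip_apply,
        LinearMap.id_apply]
      conv_rhs => rw [← hd a, TensorProduct.sum_tmul]
      exact Finset.sum_congr rfl fun i _ => (TensorProduct.smul_tmul _ _ _).symm
    | add x y hx hy =>
      simp only [map_add, TensorProduct.tmul_add, Finset.sum_add_distrib, hx, hy]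
  rw [← key t, ← key t']
  simp only [h]

theorem pairing_lid_map (P : A →ₗ[k] B →ₗ[k] k) (b b' : B) (t : A ⊗[k] A) :
    P (TensorProduct.lid k A (TensorProduct.map (P.flip b) LinearMap.id t)) b' =
      LinearMap.mul' k k (TensorProduct.map (P.flip b) (P.flip b') t) := by
  induction t using TensorProduct.induction_on with
  | zero => simp
  | tmul a x => simp
  | add x y hx hy => simp only [map_add, LinearMap.add_apply, hx, hy]

theorem tensor_ext (hd : ∀ a, ∑ i, P a (β i) • d i = a) {t t' : A ⊗[k] A}
    (h : ∀ b b', LinearMap.mul' k k (TensorProduct.map (P.flip b) (P.flip b') t) =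
      LinearMap.mul' k k (TensorProduct.map (P.flip b) (P.flip b') t')) : t = t' := by
  refine tensor_ext_left hd fun b => ?_
  refine (hd _).symm.trans (Eq.trans ?_ (hd _))
  simp only [pairing_lid_map, h]

/-- The coalgebra structure dual to an algebra structure under a nondegenerate pairing. -/
@[reducible]
def dualCoalgebra (hd : ∀ a, ∑ i, P a (β i) • d i = a) (Δ : A →ₗ[k] A ⊗[k] A)
    (hΔ : ∀ a b b', LinearMap.mul' k k (TensorProduct.map (P.flip b) (P.flip b') (Δ a)) =
      P a (b * b')) : Coalgebra k A where
  comul := Δ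
  counit := P.flip 1
  coassoc := by
    ext a
    simp only [LinearMap.comp_apply, LinearEquiv.coe_coe]
    -- Tested against b₁ ⊗ b₂ ⊗ b₃, coassociativity is the associativity of the product b₁b₂b₃.
    refine tensor_ext_left hd fun b₁ => tensor_ext hd fun b₂ b₃ => ?_
    have h1 (s : A ⊗[k] A) (a' : A) : LinearMap.mul' k k (TensorProduct.map (P.flip b₂) (P.flip b₃)
        (TensorProduct.lid k (A ⊗[k] A) (TensorProduct.map (P.flip b₁) LinearMap.id
          (TensorProduct.assoc k A A A (s ⊗ₜ[k] a'))))) =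
        LinearMap.mul' k k (TensorProduct.map (P.flip b₁) (P.flip b₂) s) * P a' b₃ := by
      induction s using TensorProduct.induction_on with
      | zero => simp
      | tmul g h => simp [mul_assoc]
      | add x y hx hy => simp only [TensorProduct.add_tmul, map_add, hx, hy, add_mul]
    have h2 (t : A ⊗[k] A) : LinearMap.mul' k k (TensorProduct.map (P.flip b₂) (P.flip b₃)
        (TensorProduct.lid k (A ⊗[k] A) (TensorProduct.map (P.flip b₁) LinearMap.id
          (TensorProduct.assoc k A A A (LinearMap.rTensor A Δ t))))) =
        LinearMap.mul' k k (TensorProduct.map (P.flip (b₁ * b₂)) (P.flip b₃) t) := by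
      induction t using TensorProduct.induction_on with
      | zero => simp
      | tmul g h =>
        rw [LinearMap.rTensor_tmul, h1, hΔ]
        simp
      | add x y hx hy => simp only [map_add, hx, hy]
    have h3 (t : A ⊗[k] A) : LinearMap.mul' k k (TensorProduct.map (P.flip b₂) (P.flip b₃)
        (TensorProduct.lid k (A ⊗[k] A) (TensorProduct.map (P.flip b₁) LinearMap.id
          (LinearMap.lTensor A Δ t)))) =
        LinearMap.mul' k k (TensorProduct.map (P.flip b₁) (P.flip (b₂ * b₃)) t) := by
      induction t using TensorProduct.induction_on with
      | zero => simp
      | tmul g h => simp [hΔ]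
      | add x y hx hy => simp only [map_add, hx, hy]
    rw [h2, h3, hΔ, hΔ, mul_assoc]
  rTensor_counit_comp_comul := by
    ext a
    apply (TensorProduct.lid k A).injective
    simp only [LinearMap.comp_apply]
    rw [← hd (TensorProduct.lid k A _), LinearMap.rTensor]
    simp only [pairing_lid_map, hΔ, one_mul, hd]
    simp
  lTensor_counit_comp_comul := by
    have h (b : B) (t : A ⊗[k] A) :
        P (TensorProduct.rid k A (TensorProduct.map LinearMap.id (P.flip 1) t)) b =
          LinearMap.mul' k k (TensorProduct.map (P.flip b) (P.flip 1) t) := by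
      induction t using TensorProduct.induction_on with
      | zero => simp
      | tmul a x => simp [mul_comm]
      | add x y hx hy => simp only [map_add, LinearMap.add_apply, hx, hy]
    ext a
    apply (TensorProduct.rid k A).injective
    simp only [LinearMap.comp_apply]
    rw [← hd (TensorProduct.rid k A _), LinearMap.lTensor]
    simp only [h, hΔ, mul_one, hd]
    simp

end DualCoalgebra

/-! ### The pairings of `A` and `B` -/

namespace SymmetricMarkovExtension

variable {k N M : Type*} [Field k] [Ring N] [Ring M] [Algebra k N] [Algebra k M]
  {ι : N →ₐ[k] M} (D : SymmetricMarkovExtension ι)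

/-- Right multiplication by elements of `U`, with values in `V`. -/
def rmulV : D.U →ₗ[k] D.V where
  toFun u := ⟨(D.rmulU u).1, by
    rintro _ ⟨m, rfl⟩
    apply BasicConstruction.toEnd_injective ι
    ext m'
    exact (mul_assoc m m' u.1).symm⟩
  map_add' u v := Subtype.ext (congrArg (fun a : D.A => a.1) (D.rmulU.map_add u v))
  map_smul' r u := Subtype.ext (congrArg (fun a : D.A => a.1) (D.rmulU.map_smul r u))

theorem rmulV_mul (u v : D.U) : D.rmulV (u * v) = D.rmulV v * D.rmulV u :=
  Subtype.ext (congrArg (fun a : D.A => a.1) (D.rmulU_mul u v))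

theorem rmulV_one : D.rmulV 1 = 1 := by
  apply Subtype.ext
  exact congrArg (fun a : D.A => a.1) D.rmulU_one

/-- An endomorphism commuting with left multiplications is right multiplication by its value at 1,
and right `N`-linearity puts that value in `U`. -/
theorem rmulV_surjective : Function.Surjective D.rmulV := by
  intro v
  have h4 (m : M) : m * BasicConstruction.toEnd ι v.1 1 = BasicConstruction.toEnd ι v.1 m := by
    have h := congrArg (fun g => BasicConstruction.toEnd ι g 1) (v.2 _ (Set.mem_range_self m))
    simpa [toEnd_leftMul] using h
  refine ⟨⟨BasicConstruction.toEnd ι v.1 1, D.mem_U_of_comm fun n => ?_⟩, ?_⟩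
  · rw [h4, ← BasicConstruction.toEnd_mul, one_mul]
  · apply Subtype.ext
    apply BasicConstruction.toEnd_injective ι
    ext m
    exact h4 m

theorem traceV_apply (v : D.V) : D.traceV v = D.T₁ v.1 := D.T₂_incl₂ v.1

/-- Dual bases of `U` for the trace `u ↦ T₀(u w)`, with `w` a central unit with inverse `z`, that
form a separability element. -/
structure SeparabilityBasis where
  n : ℕ
  p : Fin n → D.U
  q : Fin n → D.U
  w : D.U
  z : D.U
  w_mul_z : w * z = 1
  w_comm (u : D.U) : w * u = u * w
  dual_left (u : D.U) : ∑ i, D.T₀ (q i * u * w : D.U) • p i = u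
  dual_right (u : D.U) : ∑ i, D.T₀ (u * p i * w : D.U) • q i = u
  sum_mul : ∑ i, p i * q i = 1
  sum_mul_swap : ∑ i, q i * p i = 1

variable {D}

namespace SeparabilityBasis

variable (s : D.SeparabilityBasis)

theorem z_mul_w : s.z * s.w = 1 := by rw [← s.w_comm, s.w_mul_z]

/-- The element `Δ(1)` of `A ⊗ A`. -/
def comulOne : D.A ⊗[k] D.A := ∑ i, D.rmulU (s.p i) ⊗ₜ[k] D.lmulU (s.q i)

/-- T₁ = T₀ ∘ E_M, and E_M maps `A` into `U`. The dual bases of E_M in `A` therefore compose with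
those of T₀(· w) on `U`, giving dual bases of T₁ on `A`. -/
theorem exists_dual_basis (hd : HasDualBasesIn D.frobenius₁ D.A) :
    ∃ (l : ℕ) (c d : Fin l × Fin s.n → D.A), ∀ a : D.A, ∑ i, D.T₁ (c i * a : D.A) • d i = a := by
  obtain ⟨l, z, w, hz, hw, -, h⟩ := hd
  refine ⟨l, fun i => D.lmulU (s.w * s.q i.2) * ⟨w i.1, hw i.1⟩,
    fun i => ⟨z i.1, hz i.1⟩ * D.lmulU (s.p i.2), fun a => ?_⟩
  have hE (i : Fin l) : D.frobenius₁.E (w i * a.1) ∈ D.U := D.mem_U_of_comm fun n => by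
    rw [← D.frobenius₁.E_left, ← D.frobenius₁.E_right]
    have h1 := (D.A.mul_mem (hw i) a.2) _ (Set.mem_range_self n)
    exact congrArg _ h1
  have hT (i : Fin l) (j : Fin s.n) :
      D.T₁ (D.lmulU (s.w * s.q j) * ⟨w i, hw i⟩ * a : D.A) =
        D.T₀ (s.q j * ⟨_, hE i⟩ * s.w : D.U) := by
    have h1 : D.T₁ (D.lmulU (s.w * s.q j) * ⟨w i, hw i⟩ * a : D.A) =
        D.T₀ (D.frobenius₁.E (leftMul ι (s.w * s.q j : D.U).1 * (w i * a.1))) := by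
      rw [← mul_assoc]
      rfl
    rw [h1, D.frobenius₁.E_left]
    have h2 : ((s.w * s.q j : D.U) : M) * D.frobenius₁.E (w i * a.1) =
      ((s.w * (s.q j * ⟨_, hE i⟩) : D.U) : M) := by
      simp [mul_assoc]
    rw [h2, s.w_comm]
  have key (i : Fin l) : ∑ j, D.T₁ (D.lmulU (s.w * s.q j) * ⟨w i, hw i⟩ * a : D.A) •
      ((⟨z i, hz i⟩ : D.A) * D.lmulU (s.p j)) = ⟨z i, hz i⟩ * D.lmulU ⟨_, hE i⟩ := by
    conv_rhs => rw [← s.dual_left ⟨_, hE i⟩, map_sum, Finset.mul_sum]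
    refine Finset.sum_congr rfl fun j _ => ?_
    rw [hT, map_smul, mul_smul_comm]
  rw [Fintype.sum_prod_type]
  simp only [key]
  apply Subtype.ext
  rw [AddSubmonoidClass.coe_finsetSum]
  exact h a.1

variable {s}

theorem eq_zero_of_T₁ (s : D.SeparabilityBasis) (hd : HasDualBasesIn D.frobenius₁ D.A) {a : D.A}
    (h : ∀ c, D.T₁ (c * a : D.A) = 0) : a = 0 := by
  obtain ⟨l, c, d, hcd⟩ := s.exists_dual_basis hd
  rw [← hcd a]
  simp only [h, zero_smul, Finset.sum_const_zero]

/-- Non-degeneracy of T₁ identifies the transpose with its right inverse. -/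
theorem transpose_transpose (s : D.SeparabilityBasis) (hd : HasDualBasesIn D.frobenius₁ D.A)
    (a : D.A) : D.transpose (D.transpose a) = a := by
  have h : D.transpose a = D.transposeInv a := by
    rw [← sub_eq_zero]
    refine s.eq_zero_of_T₁ hd fun c => ?_
    rw [T₁_mul_comm_A, sub_mul, Subalgebra.coe_sub, map_sub, T₁_transpose_mul, sub_self]
  rw [h, transpose_transposeInv]

theorem pairing_eq_bracket (s : D.SeparabilityBasis) (a : D.A) (b : D.B) :
    D.pairing (D.rmulV s.w) a b = D.T₀ (D.bracket a (D.toA b) * s.w : D.U) := by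
  rw [pairing_apply, toEnd_toEnd_B]
  simp only [mul_one]
  congr 2
  exact one_mul s.w.1

/-- This exhibits the pairing as the trace form of `A`, twisted by the transpose and a unit, so
questions about it reduce to T₁. -/
theorem pairing_eq_T₁ (s : D.SeparabilityBasis) (hd : HasDualBasesIn D.frobenius₁ D.A) (a : D.A)
    (b : D.B) : D.pairing (D.rmulV s.w) a b =
      D.lam⁻¹ * D.T₁ (a * D.transpose (D.toA b) * D.lmulU s.w : D.A) := by
  rw [pairing_eq_bracket, mul_assoc, T₁_mul_comm_A, T₁_coe, inv_mul_cancel_left₀ D.lam_ne_zero,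
    map_sum, ← s.w_comm, Subalgebra.coe_mul, bracket]
  simp only [Finset.mul_sum, map_sum]
  refine Finset.sum_congr rfl fun i _ => ?_
  rw [ev_mul, ev_mul, T₀_ev_mul, s.transpose_transpose hd, ev_lmulU, mul_assoc]

theorem pairing'_eq_T₁ (s : D.SeparabilityBasis) (a : D.A)
    (b : D.B) : D.pairing' (D.rmulV s.w) a b =
      D.lam⁻¹ * D.T₁ (D.rmulU s.w * a * D.toA b : D.A) :=
  pairing'_apply D _ a b

theorem lmulU_w_mul_z (s : D.SeparabilityBasis) : D.lmulU s.w * D.lmulU s.z = 1 := by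
  rw [← map_mul, s.w_mul_z, map_one]

theorem lmulU_z_mul_w (s : D.SeparabilityBasis) : D.lmulU s.z * D.lmulU s.w = 1 := by
  rw [← map_mul, s.z_mul_w, map_one]

theorem rmulU_w_mul_z (s : D.SeparabilityBasis) : D.rmulU s.w * D.rmulU s.z = 1 := by
  rw [← rmulU_mul, s.z_mul_w, rmulU_one]

theorem rmulU_z_mul_w (s : D.SeparabilityBasis) : D.rmulU s.z * D.rmulU s.w = 1 := by
  rw [← rmulU_mul, s.w_mul_z, rmulU_one]

theorem exists_pairing_dual_basis (s : D.SeparabilityBasis)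
    (hd : HasDualBasesIn D.frobenius₁ D.A) :
    ∃ (l : ℕ) (β : Fin l × Fin s.n → D.B) (d : Fin l × Fin s.n → D.A),
      ∀ a : D.A, ∑ i, D.pairing (D.rmulV s.w) a (β i) • d i = a := by
  obtain ⟨l, c, d, hcd⟩ := s.exists_dual_basis hd
  -- The transpose, l(z) and λ are inserted to undo the transpose, l(w) and λ⁻¹ of `pairing_eq_T₁`,
  -- which leaves T₁(a cᵢ).
  refine ⟨l, fun i => D.equivBA.symm (D.lam • D.transpose (c i * D.lmulU s.z)), d, fun a => ?_⟩
  conv_rhs => rw [← hcd a]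
  refine Finset.sum_congr rfl fun i _ => ?_
  rw [s.pairing_eq_T₁ hd, toA_equivBA_symm, map_smul, s.transpose_transpose hd, mul_assoc,
    smul_mul_assoc, mul_assoc, s.lmulU_z_mul_w, mul_one, mul_smul_comm, T₁_mul_comm_A D (c i),
    Subalgebra.coe_smul, map_smul, smul_eq_mul, inv_mul_cancel_left₀ D.lam_ne_zero]

theorem pairing_nondegenerate (s : D.SeparabilityBasis) (hd : HasDualBasesIn D.frobenius₁ D.A) :
    (D.pairing (D.rmulV s.w)).Nondegenerate := by
  constructor
  · intro a ha
    obtain ⟨l, β, d, h⟩ := s.exists_pairing_dual_basis hd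
    rw [← h a]
    simp [ha]
  · intro b hb
    have h1 : D.transpose (D.toA b) * D.lmulU s.w = 0 := s.eq_zero_of_T₁ hd fun c => by
      have h := hb c
      rwa [s.pairing_eq_T₁ hd, mul_eq_zero_iff_left (inv_ne_zero D.lam_ne_zero), mul_assoc] at h
    have h2 : D.transpose (D.toA b) = 0 := by
      rw [← mul_one (D.transpose _), ← s.lmulU_w_mul_z, ← mul_assoc, h1, zero_mul]
    apply D.toA_injective
    apply D.transpose_injective
    rw [h2, map_zero, map_zero]

theorem pairing'_nondegenerate (s : D.SeparabilityBasis) (hd : HasDualBasesIn D.frobenius₁ D.A) :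
    (D.pairing' (D.rmulV s.w)).Nondegenerate := by
  constructor
  · intro a ha
    have h1 : D.rmulU s.w * a = 0 := s.eq_zero_of_T₁ hd fun c => by
      have h := ha (D.equivBA.symm c)
      rwa [s.pairing'_eq_T₁, mul_eq_zero_iff_left (inv_ne_zero D.lam_ne_zero),
        toA_equivBA_symm, T₁_mul_comm_A] at h
    rw [← one_mul a, ← s.rmulU_z_mul_w, mul_assoc, h1, mul_zero]
  · intro b hb
    apply D.toA_injective
    rw [map_zero]
    refine s.eq_zero_of_T₁ hd fun c => ?_
    have h := hb (D.rmulU s.z * c)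
    rwa [s.pairing'_eq_T₁, mul_eq_zero_iff_left (inv_ne_zero D.lam_ne_zero), ← mul_assoc,
      s.rmulU_w_mul_z, one_mul] at h

/-- The antipode of `A`. -/
def antipode (s : D.SeparabilityBasis) : D.A →ₗ[k] D.A :=
  LinearMap.mulLeft k (D.rmulU s.z) ∘ₗ LinearMap.mulRight k (D.rmulU s.w) ∘ₗ D.transpose

theorem antipode_apply (s : D.SeparabilityBasis) (a : D.A) :
    s.antipode a = D.rmulU s.z * (D.transpose a * D.rmulU s.w) := rfl

/-- The map `S_B` relating the two pairings. -/
def antipodeB (s : D.SeparabilityBasis) : D.B →ₗ[k] D.B :=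
  D.equivBA.symm.toLinearMap ∘ₗ LinearMap.mulRight k (D.lmulU s.w * D.rmulU s.z) ∘ₗ
    D.transpose ∘ₗ D.toA

theorem toA_antipodeB (s : D.SeparabilityBasis) (b : D.B) : D.toA (s.antipodeB b) =
    D.transpose (D.toA b) * (D.lmulU s.w * D.rmulU s.z) := D.toA_equivBA_symm _

theorem pairing_eq_pairing' (s : D.SeparabilityBasis) (hd : HasDualBasesIn D.frobenius₁ D.A)
    (a : D.A) (b : D.B) : D.pairing (D.rmulV s.w) a b =
      D.pairing' (D.rmulV s.w) a (s.antipodeB b) := by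
  rw [s.pairing_eq_T₁ hd, s.pairing'_eq_T₁, toA_antipodeB, mul_assoc (D.rmulU s.w),
    T₁_mul_comm_A D (D.rmulU s.w)]
  simp only [mul_assoc, s.rmulU_z_mul_w, mul_one]

/-- Transposing inside T₁, which is harmless by `T₁_transpose`, turns S(a) back into a; the two
sides then differ by a cyclic rotation. -/
theorem pairing_antipode (s : D.SeparabilityBasis) (hd : HasDualBasesIn D.frobenius₁ D.A)
    (hprod : D.SymmetricProduct ∨ D.TracePreserving) (a : D.A) (b : D.B) :
    D.pairing (D.rmulV s.w) (s.antipode a) b = D.pairing (D.rmulV s.w) a (s.antipodeB b) := by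
  rw [s.pairing_eq_T₁ hd, s.pairing_eq_T₁ hd, toA_antipodeB, ← T₁_transpose D hprod,
    antipode_apply]
  simp only [transpose_mul, s.transpose_transpose hd, transpose_lmulU, transpose_rmulU]
  congr 1
  rw [mul_assoc a, T₁_mul_comm_A D a]
  have h := T₁_mul_comm_A D (D.rmulU s.w * (D.toA b * (D.lmulU s.w * a))) (D.lmulU s.z)
  simp only [mul_assoc] at h ⊢
  exact h

end SeparabilityBasis

end SymmetricMarkovExtension

end

noncomputable section

/-! ### The coproduct of `A` -/

namespace SymmetricMarkovExtension

variable {k N M : Type*} [Field k] [Ring N] [Ring M] [Algebra k N] [Algebra k M]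
  {ι : N →ₐ[k] M} {D : SymmetricMarkovExtension ι}

variable (D) in
/-- The map `a ⊗ a' ↦ a(m) a'(m')`. -/
def ev₂ (m m' : M) : D.A ⊗[k] D.A →ₗ[k] M :=
  LinearMap.mul' k M ∘ₗ
    TensorProduct.map (D.ev.toLinearMap.flip m) (D.ev.toLinearMap.flip m')

@[simp]
theorem ev₂_tmul (m m' : M) (a a' : D.A) : D.ev₂ m m' (a ⊗ₜ[k] a') = D.ev a m * D.ev a' m' := rfl

namespace SeparabilityBasis

variable (s : D.SeparabilityBasis)

/-- Multiplication by Δ(1) inserts ∑ pᵢqᵢ = 1 between the two factors. -/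
theorem ev₂_comulOne_mul (m m' : M) (t : D.A ⊗[k] D.A) :
    D.ev₂ m m' (s.comulOne * t) = D.ev₂ m m' t := by
  induction t using TensorProduct.induction_on with
  | zero => simp
  | tmul a a' =>
    have h := congrArg (fun u : D.U => (u : M)) s.sum_mul
    simp only [AddSubmonoidClass.coe_finsetSum, Subalgebra.coe_mul, Subalgebra.coe_one] at h
    rw [comulOne, Finset.sum_mul, map_sum]
    simp only [Algebra.TensorProduct.tmul_mul_tmul, ev₂_tmul, ev_mul, ev_rmulU, ev_lmulU]
    have h1 (i) : D.ev a m * (s.p i).1 * ((s.q i).1 * D.ev a' m') =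
        D.ev a m * ((s.p i).1 * (s.q i).1) * D.ev a' m' := by simp only [mul_assoc]
    simp only [h1, ← Finset.sum_mul, ← Finset.mul_sum, h, mul_one]
  | add x y hx hy => simp only [mul_add, map_add, hx, hy]

/-- The duality of p and q under T₀(· w) merges a product of two traces into one. Hence Δ(1)t is
seen by the pairings only through the map m ⊗ m' ↦ t₁(m)t₂(m'), which is the injectivity behind
`tensor_ext_ev₂`. -/
theorem pairing_comulOne_mul (b b' : D.B) (t : D.A ⊗[k] D.A) :
    LinearMap.mul' k k (TensorProduct.map ((D.pairing (D.rmulV s.w)).flip b)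
      ((D.pairing (D.rmulV s.w)).flip b') (s.comulOne * t)) =
    D.T₀ ((∑ i, (∑ j, D.ev₂ (D.x i) (D.x j) t * D.ev (D.toA b') (D.y j)) *
      D.ev (D.toA b) (D.y i)) * s.w.1) := by
  induction t using TensorProduct.induction_on with
  | zero => simp
  | tmul a a' =>
    rw [comulOne, Finset.sum_mul, map_sum, map_sum]
    simp only [Algebra.TensorProduct.tmul_mul_tmul, TensorProduct.map_tmul, LinearMap.mul'_apply,
      LinearMap.flip_apply, pairing_eq_bracket]
    have h1 (l) : D.bracket (D.lmulU (s.q l) * a') (D.toA b') =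
        s.q l * D.bracket a' (D.toA b') := by
      apply Subtype.ext
      simp [bracket, Finset.mul_sum, mul_assoc]
    have h2 (l) : ((D.bracket (D.rmulU (s.p l) * a) (D.toA b) * s.w : D.U) : M) =
        ∑ i, D.ev a (D.x i) * (s.p l).1 * (D.ev (D.toA b) (D.y i) * s.w.1) := by
      simp [bracket, Finset.sum_mul, mul_assoc]
    have h3 (i) : ∑ l, D.T₀ (D.ev a (D.x i) * (s.p l).1 * (D.ev (D.toA b) (D.y i) * s.w.1)) *
        D.T₀ (s.q l * D.bracket a' (D.toA b') * s.w : D.U) =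
        D.T₀ (D.ev a (D.x i) * (D.bracket a' (D.toA b')).1 *
          (D.ev (D.toA b) (D.y i) * s.w.1)) := by
      conv_rhs => rw [← s.dual_left (D.bracket a' (D.toA b'))]
      simp only [AddSubmonoidClass.coe_finsetSum, SetLike.val_smul, Finset.mul_sum, Finset.sum_mul,
        map_sum, mul_smul_comm, smul_mul_assoc, map_smul, smul_eq_mul, mul_comm (D.T₀ (_ * _))]
    simp only [h1, h2, map_sum, Finset.sum_mul]
    rw [Finset.sum_comm]
    simp only [h3]
    simp only [bracket, ev₂_tmul, Finset.mul_sum, Finset.sum_mul, map_sum, mul_assoc]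
  | add x y hx hy =>
    rw [mul_add, map_add, map_add, hx, hy]
    simp only [map_add, add_mul, Finset.sum_add_distrib]

theorem tensor_ext_pairing (hd : HasDualBasesIn D.frobenius₁ D.A) {t t' : D.A ⊗[k] D.A}
    (h : ∀ b b', LinearMap.mul' k k (TensorProduct.map ((D.pairing (D.rmulV s.w)).flip b)
      ((D.pairing (D.rmulV s.w)).flip b') t) =
      LinearMap.mul' k k (TensorProduct.map ((D.pairing (D.rmulV s.w)).flip b)
      ((D.pairing (D.rmulV s.w)).flip b') t')) : t = t' := by
  obtain ⟨l, β, d, hβ⟩ := s.exists_pairing_dual_basis hd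
  exact tensor_ext hβ h

theorem tensor_ext_ev₂ (hd : HasDualBasesIn D.frobenius₁ D.A) {t t' : D.A ⊗[k] D.A}
    (ht : s.comulOne * t = t) (ht' : s.comulOne * t' = t')
    (h : ∀ m m', D.ev₂ m m' t = D.ev₂ m m' t') : t = t' := by
  refine s.tensor_ext_pairing hd fun b b' => ?_
  rw [← ht, ← ht', pairing_comulOne_mul, pairing_comulOne_mul]
  simp only [h]

theorem comulOne_mul_self (hd : HasDualBasesIn D.frobenius₁ D.A) :
    s.comulOne * s.comulOne = s.comulOne := by
  refine s.tensor_ext_pairing hd fun b b' => ?_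
  conv_rhs => rw [← mul_one s.comulOne]
  rw [pairing_comulOne_mul, pairing_comulOne_mul]
  have h (m m' : M) : D.ev₂ m m' s.comulOne = D.ev₂ m m' 1 := by
    simpa using s.ev₂_comulOne_mul m m' 1
  simp only [h]

/-- A coproduct on `A`: a map `Δ` with `a₁(m) a₂(m') = a(m m')` and `Δ(1) Δ(a) = Δ(a)`. -/
structure IsCoproduct (Δ : D.A →ₗ[k] D.A ⊗[k] D.A) : Prop where
  comulOne_mul (a : D.A) : s.comulOne * Δ a = Δ a
  ev₂ (a : D.A) (m m' : M) : D.ev₂ m m' (Δ a) = D.ev a (m * m')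

/-- Depth 2 expands the product am in `M₁` as ∑ E_M(a m zᵢ) wᵢ, where m ↦ E_M(a m zᵢ) is again in
`A`. Evaluating at m' gives a(mm'), and multiplication by the idempotent Δ(1) normalizes the
resulting tensor. -/
theorem exists_isCoproduct (hd : HasDualBasesIn D.frobenius₁ D.A) :
    ∃ Δ, s.IsCoproduct Δ := by
  have hd' := hd
  obtain ⟨l, z, w, hz, hw, h, -⟩ := hd
  let L (i : Fin l) : D.A →ₗ[k] D.A :=
    { toFun := fun a => D.ofEnd (D.frobenius₁.E ∘ₗ LinearMap.mulRight k (z i) ∘ₗ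
          LinearMap.mulLeft k a.1 ∘ₗ (leftMul ι).toLinearMap)
        (by
          intro m n
          simp only [LinearMap.comp_apply, LinearMap.mulRight_apply, LinearMap.mulLeft_apply,
            AlgHom.toLinearMap_apply, ← D.frobenius₁.E_right]
          have h1 := hz i _ (Set.mem_range_self n)
          simp only [AlgHom.comp_apply] at h1
          simp only [map_mul, mul_assoc, h1])
        (by
          intro n m
          simp only [LinearMap.comp_apply, LinearMap.mulRight_apply, LinearMap.mulLeft_apply,
            AlgHom.toLinearMap_apply, ← D.frobenius₁.E_left]
          have h1 := a.2 _ (Set.mem_range_self n)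
          simp only [AlgHom.comp_apply] at h1
          simp only [map_mul, ← mul_assoc, h1])
      map_add' := fun a b => A_ext fun m => by simp [add_mul]
      map_smul' := fun r a => A_ext fun m => by simp }
  have hL (i : Fin l) (a : D.A) (m : M) :
      D.ev (L i a) m = D.frobenius₁.E (a.1 * leftMul ι m * z i) := rfl
  refine ⟨LinearMap.mulLeft k s.comulOne ∘ₗ
    ∑ i, (TensorProduct.mk k D.A D.A).flip ⟨w i, hw i⟩ ∘ₗ L i, ?_, ?_⟩
  · intro a
    simp only [LinearMap.comp_apply, LinearMap.mulLeft_apply]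
    rw [← mul_assoc, s.comulOne_mul_self hd']
  · intro a m m'
    simp only [LinearMap.comp_apply, LinearMap.mulLeft_apply]
    rw [ev₂_comulOne_mul]
    simp only [LinearMap.sum_apply, LinearMap.comp_apply, LinearMap.flip_apply,
      TensorProduct.mk_apply, map_sum, ev₂_tmul, hL]
    have h1 := congrArg (fun g => BasicConstruction.toEnd ι g m') (h (a.1 * leftMul ι m))
    simp only [map_sum, LinearMap.sum_apply, map_mul, Module.End.mul_apply, toEnd_leftMul] at h1
    exact h1

theorem pairing_one (a : D.A) : D.pairing (D.rmulV s.w) a 1 = D.T₀ (D.ev a 1 * s.w.1) := by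
  rw [pairing_apply]
  congr 2
  exact one_mul s.w.1

namespace IsCoproduct

variable {s} {Δ : D.A →ₗ[k] D.A ⊗[k] D.A}

/-- By `toEnd_toEnd_B` and the Casimir property, (bb')(a)(1) = ∑ a(xᵢxⱼ) c'(yⱼ) c(yᵢ) with c =
b(e₁), c' = b'(e₁). Splitting a(xᵢxⱼ) by the coproduct is what the left side computes. -/
theorem pairing (hΔ : s.IsCoproduct Δ) (a : D.A) (b b' : D.B) :
    LinearMap.mul' k k (TensorProduct.map ((D.pairing (D.rmulV s.w)).flip b)
      ((D.pairing (D.rmulV s.w)).flip b') (Δ a)) = D.pairing (D.rmulV s.w) a (b * b') := by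
  rw [← hΔ.comulOne_mul, pairing_comulOne_mul, pairing_apply]
  have h : BasicConstruction.toEnd (leftMul ι) (b * b' : D.B).1 a.1 =
      BasicConstruction.toEnd (leftMul ι) b.1 (BasicConstruction.toEnd (leftMul ι) b'.1 a.1) := rfl
  rw [h, toEnd_toEnd_B]
  simp only [toEnd_toEnd_B, hΔ.ev₂, casimir, mul_one]
  congr 2
  exact (one_mul s.w.1).symm

/-- Reduces each formula for Δ to an evaluation on products mm'. -/
theorem eq_of_ev₂ (hΔ : s.IsCoproduct Δ) (hd : HasDualBasesIn D.frobenius₁ D.A) {a : D.A} {t : D.A ⊗[k] D.A}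
    (ht : s.comulOne * t = t) (h : ∀ m m', D.ev₂ m m' t = D.ev a (m * m')) : Δ a = t :=
  s.tensor_ext_ev₂ hd (hΔ.comulOne_mul a) ht fun m m' => by rw [hΔ.ev₂, h]

theorem map_one (hΔ : s.IsCoproduct Δ) (hd : HasDualBasesIn D.frobenius₁ D.A) : Δ 1 = s.comulOne :=
  hΔ.eq_of_ev₂ hd (s.comulOne_mul_self hd) fun m m' => by
    rw [← mul_one s.comulOne, ev₂_comulOne_mul, Algebra.TensorProduct.one_def, ev₂_tmul,
      _root_.map_one]
    rfl

theorem map_mul (hΔ : s.IsCoproduct Δ) (hd : HasDualBasesIn D.frobenius₁ D.A) (a a' : D.A) :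
    Δ (a * a') = Δ a * Δ a' := by
  refine hΔ.eq_of_ev₂ hd (by rw [← mul_assoc, hΔ.comulOne_mul]) fun m m' => ?_
  have h1 (g h : D.A) (t : D.A ⊗[k] D.A) :
      D.ev₂ m m' (t * (g ⊗ₜ[k] h)) = D.ev₂ (D.ev g m) (D.ev h m') t := by
    induction t using TensorProduct.induction_on with
    | zero => simp
    | tmul g' h' => simp
    | add x y hx hy => simp only [add_mul, map_add, hx, hy]
  have h2 (t : D.A ⊗[k] D.A) : D.ev₂ m m' (Δ a * t) = D.ev a (D.ev₂ m m' t) := by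
    induction t using TensorProduct.induction_on with
    | zero => simp
    | tmul g h => rw [h1, hΔ.ev₂, ev₂_tmul]
    | add x y hx hy => simp only [mul_add, map_add, hx, hy]
  rw [h2, hΔ.ev₂, ev_mul]

theorem map_rmulU (hΔ : s.IsCoproduct Δ) (hd : HasDualBasesIn D.frobenius₁ D.A) (u : D.U) :
    Δ (D.rmulU u) = s.comulOne * ((1 : D.A) ⊗ₜ[k] D.rmulU u) :=
  hΔ.eq_of_ev₂ hd (by rw [← mul_assoc, s.comulOne_mul_self hd]) fun m m' => by
    rw [ev₂_comulOne_mul, ev₂_tmul, _root_.map_one, ev_rmulU, ev_rmulU, mul_assoc]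
    rfl

theorem map_lmulU_mul (hΔ : s.IsCoproduct Δ) (hd : HasDualBasesIn D.frobenius₁ D.A) (u : D.U) (a : D.A) :
    Δ (D.lmulU u * a) = (D.lmulU u ⊗ₜ[k] (1 : D.A)) * Δ a := by
  have hc : s.comulOne * (D.lmulU u ⊗ₜ[k] (1 : D.A)) =
      (D.lmulU u ⊗ₜ[k] (1 : D.A)) * s.comulOne := by
    simp [comulOne, Finset.mul_sum, Finset.sum_mul, lmulU_mul_rmulU]
  refine hΔ.eq_of_ev₂ hd (by rw [← mul_assoc, hc, mul_assoc, hΔ.comulOne_mul]) fun m m' => ?_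
  rw [ev_mul, ← hΔ.ev₂]
  generalize Δ a = t
  induction t using TensorProduct.induction_on with
  | zero => simp
  | tmul g h => simp [mul_assoc]
  | add x y hx hy => simp only [mul_add, map_add, hx, hy]

end IsCoproduct

end SeparabilityBasis

end SymmetricMarkovExtension

end

noncomputable section

/-! ### The weak Hopf algebra structure of `A` -/

theorem assoc_symm_one_tmul_sum {k A κ : Type*} [Field k] [Ring A] [Algebra k A] [Fintype κ]
    (p q : κ → A) : (TensorProduct.assoc k A A A).symm ((1 : A) ⊗ₜ[k] ∑ i, p i ⊗ₜ[k] q i) =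
      ∑ i, ((1 : A) ⊗ₜ[k] p i) ⊗ₜ[k] q i := by
  rw [TensorProduct.tmul_sum, map_sum]
  simp only [TensorProduct.assoc_symm_tmul]

namespace SymmetricMarkovExtension

variable {k N M : Type*} [Field k] [Ring N] [Ring M] [Algebra k N] [Algebra k M]
  {ι : N →ₐ[k] M} {D : SymmetricMarkovExtension ι}

namespace SeparabilityBasis

variable (s : D.SeparabilityBasis)

/-- The counit `a ↦ ⟨a, 1⟩` of `A`. -/
def counit : D.A →ₗ[k] k := (D.pairing (D.rmulV s.w)).flip 1

theorem counit_apply (a : D.A) : s.counit a = D.T₀ (D.ev a 1 * s.w.1) := s.pairing_one a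

theorem counit_eq_evU (a : D.A) (u : D.U) (h : D.ev a 1 = u.1) :
    s.counit a = D.T₀ (u * s.w : D.U) := by
  rw [counit_apply, h, Subalgebra.coe_mul]

theorem targetCounit_eq (a : D.A) : TensorProduct.lid k D.A (TensorProduct.map s.counit
    LinearMap.id (s.comulOne * (a ⊗ₜ[k] (1 : D.A)))) = D.lmulU (D.evU a 1) := by
  conv_rhs => rw [← s.dual_right (D.evU a 1), map_sum]
  rw [comulOne, Finset.sum_mul, map_sum, map_sum]
  refine Finset.sum_congr rfl fun i _ => ?_
  rw [Algebra.TensorProduct.tmul_mul_tmul, TensorProduct.map_tmul, TensorProduct.lid_tmul, mul_one,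
    LinearMap.id_apply, map_smul, s.counit_eq_evU _ (D.evU a 1 * s.p i)]
  rfl

theorem sourceCounit_eq_sum (a : D.A) : TensorProduct.rid k D.A (TensorProduct.map LinearMap.id
    s.counit (((1 : D.A) ⊗ₜ[k] a) * s.comulOne)) =
      ∑ i, s.counit (a * D.lmulU (s.q i)) • D.rmulU (s.p i) := by
  rw [comulOne, Finset.mul_sum, map_sum, map_sum]
  simp

/-- The coefficient T₀(a(qᵢ)w) equals T₀(qᵢ aᵗ(w)). Writing aᵗ(w) as (aᵗ(w)z)w matches the dual
basis expansion. -/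
theorem sourceCounit_eq (a : D.A) : TensorProduct.rid k D.A (TensorProduct.map LinearMap.id
    s.counit (((1 : D.A) ⊗ₜ[k] a) * s.comulOne)) =
      D.rmulU (D.evU (D.transpose a) s.w * s.z) := by
  rw [sourceCounit_eq_sum]
  conv_rhs => rw [← s.dual_left (D.evU (D.transpose a) s.w * s.z), map_sum]
  refine Finset.sum_congr rfl fun i _ => ?_
  rw [map_smul, counit_apply, mul_assoc (s.q i), mul_assoc (D.evU _ _), s.z_mul_w, mul_one, ev_mul,
    ev_lmulU, mul_one, T₀_ev_mul]
  rfl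

theorem antipode_mul_lmulU (a : D.A) (u : D.U) :
    s.antipode (a * D.lmulU u) = D.rmulU u * s.antipode a := by
  have hz : D.rmulU s.z * D.rmulU u = D.rmulU u * D.rmulU s.z := by
    rw [← rmulU_mul, ← rmulU_mul]
    congr 1
    calc u * s.z = (s.z * s.w) * u * s.z := by rw [s.z_mul_w, one_mul]
      _ = s.z * (s.w * u) * s.z := by simp only [mul_assoc]
      _ = s.z * u * (s.w * s.z) := by rw [s.w_comm]; simp only [mul_assoc]
      _ = s.z * u := by rw [s.w_mul_z, mul_one]
  rw [antipode_apply, antipode_apply, transpose_mul, transpose_lmulU]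
  simp only [← mul_assoc, hz]

theorem antipode_one : s.antipode 1 = 1 := by
  have h := D.transpose_lmulU 1
  rw [map_one, rmulU_one] at h
  rw [antipode_apply, h, one_mul, s.rmulU_z_mul_w]

theorem ev_antipode (a : D.A) (m : M) : D.ev (s.antipode a) m =
    (∑ i, D.x i * ι (D.E (D.ev a (D.y i) * (m * s.w.1)))) * s.z.1 := by
  rw [antipode_apply, ev_mul, ev_mul, ev_rmulU, ev_rmulU, ev_transpose]

/-- The map `g ⊗ h ↦ T₁(h) g`. -/
def traceSlice (_ : D.SeparabilityBasis) : D.A ⊗[k] D.A →ₗ[k] D.A :=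
  (TensorProduct.rid k D.A).toLinearMap ∘ₗ
    TensorProduct.map LinearMap.id (D.T₁ ∘ₗ D.A.val.toLinearMap)

@[simp]
theorem traceSlice_tmul (g h : D.A) : s.traceSlice (g ⊗ₜ[k] h) = D.T₁ h.1 • g := by
  simp [traceSlice]

theorem traceSlice_mul_left (g : D.A) (t : D.A ⊗[k] D.A) :
    s.traceSlice ((g ⊗ₜ[k] (1 : D.A)) * t) = g * s.traceSlice t := by
  induction t using TensorProduct.induction_on with
  | zero => simp
  | tmul a a' => simp
  | add x y hx hy => simp only [mul_add, map_add, hx, hy]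

/-- The dual basis of `U` absorbs the legs of Δ(1). For t = Δ(e₁) the right side becomes λ ∑ E(m
a(xᵢ)) yᵢ, so the coproduct of the Jones element recovers the transpose and hence the antipode. -/
theorem ev_traceSlice (a : D.A) (t : D.A ⊗[k] D.A) (m : M) :
    D.ev (s.traceSlice (((1 : D.A) ⊗ₜ[k] (a * D.lmulU s.w)) * (s.comulOne * t))) m =
      D.lam • ∑ i, D.ev₂ m (D.ev a (D.x i)) t * D.y i := by
  induction t using TensorProduct.induction_on with
  | zero => simp
  | tmul g h =>
    have h1 (l) : D.T₁ (a * D.lmulU s.w * (D.lmulU (s.q l) * h) : D.A) =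
        D.lam * D.T₀ (s.q l * D.bracket (h * a) 1 * s.w : D.U) := by
      rw [mul_assoc a, T₁_mul_comm_A, T₁_coe, ← s.w_comm]
      simp only [ev_mul, ev_lmulU, Subalgebra.coe_mul, bracket, map_one, Module.End.one_apply,
        Finset.mul_sum, mul_assoc]
    have h2 : (s.traceSlice (((1 : D.A) ⊗ₜ[k] (a * D.lmulU s.w)) * (s.comulOne * g ⊗ₜ[k] h))) =
        D.lam • (D.rmulU (D.bracket (h * a) 1) * g) := by
      conv_rhs => rw [← s.dual_left (D.bracket (h * a) 1)]
      rw [comulOne, Finset.sum_mul, Finset.mul_sum, map_sum, map_sum, Finset.sum_mul,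
        Finset.smul_sum]
      refine Finset.sum_congr rfl fun l _ => ?_
      rw [Algebra.TensorProduct.tmul_mul_tmul, Algebra.TensorProduct.tmul_mul_tmul,
        traceSlice_tmul, h1, map_smul, smul_mul_assoc, smul_smul, one_mul]
    rw [h2, map_smul, LinearMap.smul_apply, ev_mul, ev_rmulU]
    simp [bracket, Finset.mul_sum, mul_assoc]
  | add x y hx hy =>
    simp only [mul_add, map_add, LinearMap.add_apply, hx, hy, add_mul, Finset.sum_add_distrib,
      smul_add]

namespace IsCoproduct

variable {s} {Δ : D.A →ₗ[k] D.A ⊗[k] D.A}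

theorem traceSlice_jonesA (hΔ : s.IsCoproduct Δ) (hd : HasDualBasesIn D.frobenius₁ D.A)
    (a : D.A) : s.traceSlice (((1 : D.A) ⊗ₜ[k] (a * D.lmulU s.w)) * Δ D.jonesA) =
      D.lam • D.transpose a := by
  have h : D.transpose a = D.transposeInv a := by
    rw [← s.transpose_transpose hd (D.transposeInv a), transpose_transposeInv]
  apply A_ext
  intro m
  rw [← hΔ.comulOne_mul, ev_traceSlice, map_smul, LinearMap.smul_apply, h, ev_transposeInv]
  simp only [hΔ.ev₂, ev_jonesA]

theorem antipode_eq (hΔ : s.IsCoproduct Δ) (hd : HasDualBasesIn D.frobenius₁ D.A) (a : D.A) :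
    s.antipode a =
      D.lam⁻¹ • (s.traceSlice (((1 : D.A) ⊗ₜ[k] a) * Δ D.jonesA) * D.rmulU s.w) := by
  have h := hΔ.traceSlice_jonesA hd (a * D.lmulU s.z)
  rw [mul_assoc, s.lmulU_z_mul_w, mul_one, transpose_mul, transpose_lmulU] at h
  rw [h, smul_mul_assoc, inv_smul_smul₀ D.lam_ne_zero, antipode_apply, mul_assoc]

/-- The Jones element is a left integral: a e₁ = l(a(1)) e₁. Expressing S through Δ(e₁), the sum
a₁S(a₂) only involves Δ(a)Δ(e₁) = Δ(a e₁), from which l(a(1)) factors out and leaves S(1) = 1. -/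
theorem mul_antipode_eq (hΔ : s.IsCoproduct Δ) (hd : HasDualBasesIn D.frobenius₁ D.A) (a : D.A) :
    LinearMap.mul' k D.A (TensorProduct.map LinearMap.id s.antipode (Δ a)) =
      D.lmulU (D.evU a 1) := by
  have h1 (t : D.A ⊗[k] D.A) :
      LinearMap.mul' k D.A (TensorProduct.map LinearMap.id s.antipode t) =
        D.lam⁻¹ • (s.traceSlice (t * Δ D.jonesA) * D.rmulU s.w) := by
    induction t using TensorProduct.induction_on with
    | zero => simp
    | tmul g h =>
      have h2 : g ⊗ₜ[k] h = (g ⊗ₜ[k] (1 : D.A)) * ((1 : D.A) ⊗ₜ[k] h) := by simp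
      rw [h2, mul_assoc, traceSlice_mul_left, mul_assoc, ← mul_smul_comm, ← hΔ.antipode_eq hd, ← h2]
      simp
    | add x y hx hy => simp only [map_add, hx, hy, add_mul, smul_add]
  have h3 : a * D.jonesA = D.lmulU (D.evU a 1) * D.jonesA := A_ext fun m => by
    have h := D.ev_mul_right a 1 (D.E m)
    rw [one_mul] at h
    exact h
  have h4 := hΔ.antipode_eq hd 1
  rw [antipode_one, ← Algebra.TensorProduct.one_def, one_mul] at h4
  rw [h1, ← hΔ.map_mul hd, h3, hΔ.map_lmulU_mul hd, traceSlice_mul_left, mul_assoc,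
    ← mul_smul_comm, ← h4, mul_one]

/-- At m the left side is ∑ xᵢ E(a₁(yᵢ)a₂(m)w) z = ∑ xᵢ E(yᵢ m aᵗ(w)) z, and the dual bases collapse
it to m aᵗ(w) z. -/
theorem antipode_mul_eq (hΔ : s.IsCoproduct Δ) (a : D.A) :
    LinearMap.mul' k D.A (TensorProduct.map s.antipode LinearMap.id (Δ a)) =
      D.rmulU (D.evU (D.transpose a) s.w * s.z) := by
  have h1 (t : D.A ⊗[k] D.A) (m : M) :
      D.ev (LinearMap.mul' k D.A (TensorProduct.map s.antipode LinearMap.id t)) m =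
        (∑ i, D.x i * ι (D.E (D.ev₂ (D.y i) m t * s.w.1))) * s.z.1 := by
    induction t using TensorProduct.induction_on with
    | zero => simp
    | tmul g h =>
      rw [TensorProduct.map_tmul, LinearMap.mul'_apply, ev_mul, ev_antipode]
      simp [mul_assoc]
    | add x y hx hy =>
      simp only [map_add, LinearMap.add_apply, hx, hy, add_mul, mul_add, Finset.sum_add_distrib]
  apply A_ext
  intro m
  rw [h1, ev_rmulU]
  simp only [hΔ.ev₂, E_ev_mul, mul_assoc (D.y _), D.dual_right]
  simp [evU, mul_assoc]

/-- ε_s(a₁)S(a₂) = S(∑ ε(a₁ l(q)) a₂ l(p)), because S(h l(u)) = r(u)S(h). The argument of S sends m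
to ∑ a₁(q)a₂(pm) = a(∑ qp m) = a(m). -/
theorem antipode_mul_antipode_eq (hΔ : s.IsCoproduct Δ) (a : D.A) : LinearMap.mul' k D.A
    (TensorProduct.map (LinearMap.mul' k D.A ∘ₗ TensorProduct.map s.antipode LinearMap.id ∘ₗ Δ)
      s.antipode (Δ a)) = s.antipode a := by
  let H (l : Fin s.n) : D.A ⊗[k] D.A →ₗ[k] D.A := (TensorProduct.lid k D.A).toLinearMap ∘ₗ
    TensorProduct.map (s.counit ∘ₗ LinearMap.mulRight k (D.lmulU (s.q l)))
      (LinearMap.mulRight k (D.lmulU (s.p l)))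
  have hH (l : Fin s.n) (g h : D.A) : H l (g ⊗ₜ[k] h) =
      s.counit (g * D.lmulU (s.q l)) • (h * D.lmulU (s.p l)) := by simp [H]
  have h1 (t : D.A ⊗[k] D.A) : LinearMap.mul' k D.A
      (TensorProduct.map (LinearMap.mul' k D.A ∘ₗ TensorProduct.map s.antipode LinearMap.id ∘ₗ Δ)
        s.antipode t) = s.antipode (∑ l, H l t) := by
    induction t using TensorProduct.induction_on with
    | zero => simp
    | tmul g h =>
      simp only [TensorProduct.map_tmul, LinearMap.comp_apply, hΔ.antipode_mul_eq,
        ← sourceCounit_eq, sourceCounit_eq_sum, LinearMap.mul'_apply, Finset.sum_mul, map_sum, hH,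
        map_smul, antipode_mul_lmulU, smul_mul_assoc]
    | add x y hx hy => simp only [map_add, hx, hy, Finset.sum_add_distrib]
  have h2 (t : D.A ⊗[k] D.A) (l : Fin s.n) (m : M) : D.ev (H l (s.comulOne * t)) m =
      D.ev₂ (s.q l).1 ((s.p l).1 * m) t := by
    induction t using TensorProduct.induction_on with
    | zero => simp
    | tmul g h =>
      have h3 : H l (s.comulOne * g ⊗ₜ[k] h) =
          D.lmulU (D.evU g (s.q l)) * (h * D.lmulU (s.p l)) := by
        conv_rhs => rw [← s.dual_right (D.evU g (s.q l)), map_sum, Finset.sum_mul]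
        rw [comulOne, Finset.sum_mul, map_sum]
        refine Finset.sum_congr rfl fun j _ => ?_
        have h4 : D.ev (D.rmulU (s.p j) * g * D.lmulU (s.q l)) 1 =
            (D.evU g (s.q l) * s.p j : D.U).1 := by
          rw [ev_mul, ev_lmulU, mul_one]
          rfl
        rw [Algebra.TensorProduct.tmul_mul_tmul, hH, map_smul, smul_mul_assoc, mul_assoc (D.lmulU _),
          s.counit_eq_evU _ _ h4]
      rw [h3, ev_mul, ev_mul]
      rfl
    | add x y hx hy => simp only [map_add, LinearMap.add_apply, mul_add, hx, hy]
  rw [h1]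
  congr 1
  apply A_ext
  intro m
  have h4 := congrArg (fun u : D.U => (u : M)) s.sum_mul_swap
  simp only [AddSubmonoidClass.coe_finsetSum, Subalgebra.coe_mul, Subalgebra.coe_one] at h4
  rw [← hΔ.comulOne_mul, map_sum, LinearMap.sum_apply]
  simp only [h2, hΔ.ev₂, ← mul_assoc, ← map_sum, ← Finset.sum_mul, h4, one_mul]

/-- Duality of p and q fuses the two counits into T₀(h(g₁(1) g₂(f(1))) w), and g₁(1)g₂(f(1)) =
g(f(1)). The opposite version swaps the arguments and uses the other dual basis identity. -/
theorem counit_mul (hΔ : s.IsCoproduct Δ) (h g f : D.A) : s.counit (h * g * f) =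
    LinearMap.mul' k k (TensorProduct.map (s.counit ∘ₗ LinearMap.mulLeft k h)
      (s.counit ∘ₗ LinearMap.mulRight k f) (Δ g)) := by
  have h1 (t : D.A ⊗[k] D.A) : LinearMap.mul' k k (TensorProduct.map
      (s.counit ∘ₗ LinearMap.mulLeft k h) (s.counit ∘ₗ LinearMap.mulRight k f)
      (s.comulOne * t)) = D.T₀ (D.ev h (D.ev₂ 1 (D.ev f 1) t) * s.w.1) := by
    induction t using TensorProduct.induction_on with
    | zero => simp
    | tmul a b =>
      have h2 := congrArg (fun u : D.U => D.T₀ (D.ev h (D.ev a 1 * u.1) * s.w.1))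
        (s.dual_left (D.evU b (D.evU f 1)))
      refine Eq.trans ?_ h2
      rw [comulOne, Finset.sum_mul, map_sum, map_sum]
      simp only [AddSubmonoidClass.coe_finsetSum, SetLike.val_smul, Finset.mul_sum, Finset.sum_mul,
        map_sum, mul_smul_comm, smul_mul_assoc, map_smul, smul_eq_mul]
      refine Finset.sum_congr rfl fun j _ => ?_
      rw [Algebra.TensorProduct.tmul_mul_tmul, TensorProduct.map_tmul, LinearMap.mul'_apply,
        LinearMap.comp_apply, LinearMap.comp_apply, LinearMap.mulLeft_apply,
        LinearMap.mulRight_apply, counit_apply, counit_apply, mul_comm]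
      rfl
    | add x y hx hy => simp only [map_add, mul_add, hx, hy, add_mul]
  rw [← hΔ.comulOne_mul, h1, hΔ.ev₂, one_mul, counit_apply]
  rfl

theorem counit_mul_op (hΔ : s.IsCoproduct Δ) (h g f : D.A) : s.counit (h * g * f) =
    LinearMap.mul' k k (TensorProduct.map (s.counit ∘ₗ LinearMap.mulRight k f)
      (s.counit ∘ₗ LinearMap.mulLeft k h) (Δ g)) := by
  have h1 (t : D.A ⊗[k] D.A) : LinearMap.mul' k k (TensorProduct.map
      (s.counit ∘ₗ LinearMap.mulRight k f) (s.counit ∘ₗ LinearMap.mulLeft k h)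
      (s.comulOne * t)) = D.T₀ (D.ev h (D.ev₂ (D.ev f 1) 1 t) * s.w.1) := by
    induction t using TensorProduct.induction_on with
    | zero => simp
    | tmul a b =>
      have h2 := congrArg (fun u : D.U => D.T₀ (D.ev h (u.1 * D.ev b 1) * s.w.1))
        (s.dual_right (D.evU a (D.evU f 1)))
      refine Eq.trans ?_ h2
      rw [comulOne, Finset.sum_mul, map_sum, map_sum]
      simp only [AddSubmonoidClass.coe_finsetSum, SetLike.val_smul, Finset.sum_mul, map_sum,
        smul_mul_assoc, map_smul, smul_eq_mul]
      refine Finset.sum_congr rfl fun j _ => ?_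
      rw [Algebra.TensorProduct.tmul_mul_tmul, TensorProduct.map_tmul, LinearMap.mul'_apply,
        LinearMap.comp_apply, LinearMap.comp_apply, LinearMap.mulLeft_apply,
        LinearMap.mulRight_apply, counit_apply, counit_apply]
      rfl
    | add x y hx hy => simp only [map_add, mul_add, hx, hy, add_mul]
  rw [← hΔ.comulOne_mul, h1, hΔ.ev₂, mul_one, counit_apply]
  rfl

theorem map_comulOne (hΔ : s.IsCoproduct Δ) (hd : HasDualBasesIn D.frobenius₁ D.A) :
    TensorProduct.map Δ (LinearMap.id : D.A →ₗ[k] D.A) s.comulOne =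
    (s.comulOne ⊗ₜ[k] (1 : D.A)) *
      (TensorProduct.assoc k D.A D.A D.A).symm ((1 : D.A) ⊗ₜ[k] s.comulOne) := by
  conv_lhs => rw [comulOne, map_sum]
  conv_rhs => enter [2]; rw [comulOne, assoc_symm_one_tmul_sum]
  rw [Finset.mul_sum]
  refine Finset.sum_congr rfl fun i _ => ?_
  rw [TensorProduct.map_tmul, hΔ.map_rmulU hd,
    Algebra.TensorProduct.tmul_mul_tmul, one_mul, LinearMap.id_apply]

/-- The two factors meet only in the middle leg, where left and right multiplications by `U`
commute. -/
theorem map_comulOne_op (hΔ : s.IsCoproduct Δ) (hd : HasDualBasesIn D.frobenius₁ D.A) :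
    TensorProduct.map Δ (LinearMap.id : D.A →ₗ[k] D.A) s.comulOne =
      (TensorProduct.assoc k D.A D.A D.A).symm ((1 : D.A) ⊗ₜ[k] s.comulOne) *
        (s.comulOne ⊗ₜ[k] (1 : D.A)) := by
  rw [hΔ.map_comulOne hd]
  conv_lhs => enter [2]; rw [comulOne, assoc_symm_one_tmul_sum]
  conv_rhs => enter [1]; rw [comulOne, assoc_symm_one_tmul_sum]
  rw [Finset.mul_sum, Finset.sum_mul]
  refine Finset.sum_congr rfl fun i _ => ?_
  rw [Algebra.TensorProduct.tmul_mul_tmul,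
    Algebra.TensorProduct.tmul_mul_tmul, one_mul, mul_one]
  congr 1
  simp [comulOne, Finset.mul_sum, Finset.sum_mul, lmulU_mul_rmulU]

theorem exists_weakHopfAlgebra (hΔ : s.IsCoproduct Δ) (hd : HasDualBasesIn D.frobenius₁ D.A) :
    ∃ W : WeakHopfAlgebra k D.A, W.comul = Δ ∧ W.counit = s.counit ∧ W.antipode = s.antipode := by
  obtain ⟨l, β, d, hβ⟩ := s.exists_pairing_dual_basis hd
  refine ⟨{ dualCoalgebra hβ Δ hΔ.pairing with
    comul_mul := hΔ.map_mul hd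
    counit_mul := hΔ.counit_mul
    counit_mul_op := hΔ.counit_mul_op
    comul_one := ?_
    comul_one_op := ?_
    antipode := s.antipode
    mul_antipode := ?_
    antipode_mul := ?_
    antipode_mul_antipode := hΔ.antipode_mul_antipode_eq }, rfl, rfl, rfl⟩
  · change TensorProduct.map Δ LinearMap.id (Δ 1) = (Δ 1 ⊗ₜ[k] 1) *
      (TensorProduct.assoc k D.A D.A D.A).symm (1 ⊗ₜ[k] Δ 1)
    rw [hΔ.map_one hd]
    exact hΔ.map_comulOne hd
  · change TensorProduct.map Δ LinearMap.id (Δ 1) =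
      (TensorProduct.assoc k D.A D.A D.A).symm (1 ⊗ₜ[k] Δ 1) * (Δ 1 ⊗ₜ[k] 1)
    rw [hΔ.map_one hd]
    exact hΔ.map_comulOne_op hd
  · intro a
    change LinearMap.mul' k D.A (TensorProduct.map LinearMap.id s.antipode (Δ a)) =
      TensorProduct.lid k D.A (TensorProduct.map s.counit LinearMap.id (Δ 1 * (a ⊗ₜ[k] 1)))
    rw [hΔ.map_one hd, hΔ.mul_antipode_eq hd, targetCounit_eq]
  · intro a
    change LinearMap.mul' k D.A (TensorProduct.map s.antipode LinearMap.id (Δ a)) =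
      TensorProduct.rid k D.A (TensorProduct.map LinearMap.id s.counit ((1 ⊗ₜ[k] a) * Δ 1))
    rw [hΔ.map_one hd, hΔ.antipode_mul_eq, sourceCounit_eq]

end IsCoproduct

end SeparabilityBasis

end SymmetricMarkovExtension

end

noncomputable section

/-! ### The adjoint action -/

namespace SymmetricMarkovExtension

variable {k N M : Type*} [Field k] [Ring N] [Ring M] [Algebra k N] [Algebra k M]
  {ι : N →ₐ[k] M} {D : SymmetricMarkovExtension ι}

theorem toEnd_adjointAction [WeakHopfAlgebra k D.A] (a : D.A) (m m' : M) :
    BasicConstruction.toEnd ι (D.adjointAction a m) m' =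
      LinearMap.mul' k (Module.End k M) (TensorProduct.map
        (LinearMap.mulRight k (Algebra.lmul k M m) ∘ₗ D.ev.toLinearMap)
        (D.ev.toLinearMap ∘ₗ WeakHopfAlgebra.antipode (k := k))
        (Coalgebra.comul (R := k) a)) m' := by
  rw [adjointAction]
  generalize Coalgebra.comul (R := k) a = t
  induction t using TensorProduct.induction_on with
  | zero => simp
  | tmul g h =>
    simp only [TensorProduct.map_tmul, LinearMap.mul'_apply, map_mul, LinearMap.comp_apply,
      LinearMap.mulRight_apply, Module.End.mul_apply]
    rfl
  | add x y hx hy => simp only [map_add, LinearMap.add_apply, hx, hy]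

namespace SeparabilityBasis.IsCoproduct

variable {s : D.SeparabilityBasis} {Δ : D.A →ₗ[k] D.A ⊗[k] D.A}

-- Applied to m', a₁ m S(a₂) gives a₁(m) · (a₂S(a₃))(m') after the coproduct distributes a₁ over the
-- product. Coassociativity and a₂S(a₃) = l(a₂(1)) reduce this to a₁(m)a₂(1)m' = a(m)m'.
set_option synthInstance.maxHeartbeats 200000 in
theorem adjointAction_eq (hΔ : s.IsCoproduct Δ) (hd : HasDualBasesIn D.frobenius₁ D.A)
    [W : WeakHopfAlgebra k D.A] (h₁ : W.comul = Δ) (h₂ : W.antipode = s.antipode)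
    (a : D.A) (m : M) : D.adjointAction a m = D.incl₁ (D.ev a m) := by
  apply BasicConstruction.toEnd_injective ι
  ext m'
  rw [toEnd_adjointAction, toEnd_leftMul, h₁, h₂]
  -- Ψ sends g ⊗ h ⊗ h' to g(m) · (h S(h'))(m'), so both bracketings of the iterated coproduct can
  -- be compared through it.
  let Ψ : D.A ⊗[k] (D.A ⊗[k] D.A) →ₗ[k] M := LinearMap.mul' k M ∘ₗ
    TensorProduct.map (D.ev.toLinearMap.flip m) (LinearMap.applyₗ m' ∘ₗ D.ev.toLinearMap ∘ₗ
      LinearMap.mul' k D.A ∘ₗ TensorProduct.map LinearMap.id s.antipode)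
  have hΨ (g : D.A) (t : D.A ⊗[k] D.A) : Ψ (g ⊗ₜ[k] t) = D.ev g m *
      D.ev (LinearMap.mul' k D.A (TensorProduct.map LinearMap.id s.antipode t)) m' := rfl
  have h3 (t : D.A ⊗[k] D.A) (h : D.A) : Ψ (TensorProduct.assoc k D.A D.A D.A (t ⊗ₜ[k] h)) =
      D.ev₂ m (D.ev (s.antipode h) m') t := by
    induction t using TensorProduct.induction_on with
    | zero => simp
    | tmul g g' =>
      rw [TensorProduct.assoc_tmul, hΨ, TensorProduct.map_tmul, LinearMap.mul'_apply, ev_mul]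
      rfl
    | add x y hx hy => simp only [TensorProduct.add_tmul, map_add, hx, hy]
  have h4 (t : D.A ⊗[k] D.A) : LinearMap.mul' k (Module.End k M) (TensorProduct.map
      (LinearMap.mulRight k (Algebra.lmul k M m) ∘ₗ D.ev.toLinearMap)
      (D.ev.toLinearMap ∘ₗ s.antipode) t) m' =
      Ψ (TensorProduct.assoc k D.A D.A D.A (LinearMap.rTensor D.A Δ t)) := by
    induction t using TensorProduct.induction_on with
    | zero => simp
    | tmul g h =>
      rw [LinearMap.rTensor_tmul, h3, hΔ.ev₂]
      rfl
    | add x y hx hy => simp only [map_add, LinearMap.add_apply, hx, hy]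
  have h5 (t : D.A ⊗[k] D.A) : Ψ (LinearMap.lTensor D.A Δ t) = D.ev₂ m 1 t * m' := by
    induction t using TensorProduct.induction_on with
    | zero => simp
    | tmul g h =>
      rw [LinearMap.lTensor_tmul, hΨ, hΔ.mul_antipode_eq hd, ev_lmulU, ev₂_tmul, mul_assoc]
      rfl
    | add x y hx hy => simp only [map_add, hx, hy, add_mul]
  have h6 := LinearMap.congr_fun W.coassoc a
  rw [h₁] at h6
  rw [h4]
  refine (congrArg Ψ h6).trans ?_
  refine (h5 (Δ a)).trans ?_
  rw [hΔ.ev₂, mul_one]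

theorem isModuleAlgebra (hΔ : s.IsCoproduct Δ) (hd : HasDualBasesIn D.frobenius₁ D.A)
    [W : WeakHopfAlgebra k D.A] (h₁ : W.comul = Δ) (h₂ : W.counit = s.counit) :
    WeakHopfAlgebra.IsModuleAlgebra D.ev where
  act_mul h a b := by
    rw [h₁]
    exact (hΔ.ev₂ h a b).symm
  act_one h := by
    have h3 : WeakHopfAlgebra.targetCounit k h = D.lmulU (D.evU h 1) := by
      rw [WeakHopfAlgebra.targetCounit, h₁, h₂, hΔ.map_one hd, targetCounit_eq]
    rw [h3, ev_lmulU, mul_one]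
    rfl

end SeparabilityBasis.IsCoproduct

end SymmetricMarkovExtension

end

/-! ### Transfer from `U` to `V` and assembly of the structure -/

theorem mainTheorem7 {k N M : Type*} [Field k] [Ring N] [Ring M] [Algebra k N] [Algebra k M]
    {ι : N →ₐ[k] M} (D : SymmetricMarkovExtension ι)
    (hprod : D.SymmetricProduct ∨ D.TracePreserving)
    (hirr : D.WeaklyIrreducible) (hdepth : D.DepthTwo) :
    ∃ f : D.V ⊗[k] D.V, (∀ f' : D.V ⊗[k] D.V, IsSymmSepElement f' ↔ f' = f) ∧
    ∃ w : D.V, w * D.slice f = 1 ∧ D.slice f * w = 1 ∧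
      (D.pairing w).Nondegenerate ∧ (D.pairing' w).Nondegenerate ∧
    ∃ SB : D.B →ₗ[k] D.B, (∀ (a : D.A) (b : D.B), D.pairing w a b = D.pairing' w a (SB b)) ∧
    ∃ _ : WeakHopfAlgebra k D.A, D.IsDualStructure w SB ∧
      (∀ (a : D.A) (m : M), D.adjointAction a m ∈ D.incl₁.range) ∧
      ∃ act : D.A →ₐ[k] Module.End k M,
        (∀ (a : D.A) (m : M), D.incl₁ (act a m) = D.adjointAction a m) ∧
        WeakHopfAlgebra.IsModuleAlgebra act := by
  obtain ⟨⟨f, hf⟩, hnd⟩ := hirr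
  have hd := hdepth.1
  obtain ⟨n, p, q, hp, rfl⟩ := exists_tensor_eq_sum f
  have hτ (u v : D.U) : D.T₀ (u * v : D.U) = D.T₀ (v * u : D.U) := D.T₀_mul_comm u.1 v.1
  have hndU (u : D.U) (h : ∀ v : D.U, D.T₀ (u * v : D.U) = 0) : u = 0 :=
    Subtype.ext (hnd u.1 u.2 fun v hv => h ⟨v, hv⟩)
  obtain ⟨w, hw, hwc, hd1, hd2⟩ :=
    hf.exists_inverse (τ := D.T₀ ∘ₗ D.U.val.toLinearMap) hτ hndU hp
  have hw' := hw
  rw [hwc] at hw'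
  -- The field z is the slice of f by T₀, the unit inverted by w.
  let s : D.SeparabilityBasis := ⟨n, p, q, w, _, hw, hwc, hd1, hd2, hf.sum_mul, hf.sum_mul_swap⟩
  have hV (u : D.U) : D.traceV (D.rmulV u) = D.T₀ u.1 :=
    (D.traceV_apply _).trans (D.T₁_rmulU hprod u)
  have hτV (v v' : D.V) : D.traceV (v * v') = D.traceV (v' * v) := by
    rw [D.traceV_apply, D.traceV_apply]
    exact D.T₁_mul_comm v.1 v'.1
  have hndV (v : D.V) (h : ∀ v' : D.V, D.traceV (v * v') = 0) : v = 0 := by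
    obtain ⟨u, rfl⟩ := D.rmulV_surjective v
    rw [hndU u fun u' => by
      have h' := h (D.rmulV u')
      rwa [← D.rmulV_mul, hV, ← hτ] at h', map_zero]
  -- Right multiplication is an anti-isomorphism from `U` to `V` carrying T₀ to T by `T₁_rmulU`, so
  -- the separability element, its slice and the inverse are all transported.
  have hfV := hf.map_antihom D.rmulV D.rmulV_one D.rmulV_mul D.rmulV_surjective
  have hslice : D.slice (TensorProduct.map D.rmulV D.rmulV (∑ i, p i ⊗ₜ[k] q i)) =
      D.rmulV s.z := by
    simp only [SymmetricMarkovExtension.slice, map_sum, TensorProduct.map_tmul,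
      TensorProduct.rid_tmul, LinearMap.id_apply, hV, s, map_smul]
    rfl
  obtain ⟨Δ, hΔ⟩ := s.exists_isCoproduct hd
  obtain ⟨W, h₁, h₂, h₃⟩ := hΔ.exists_weakHopfAlgebra hd
  refine ⟨_, fun f' => ⟨fun hf' => hf'.eq_of_nondegenerate hτV hndV hfV, fun h => h ▸ hfV⟩,
    D.rmulV s.w, ?_, ?_, s.pairing_nondegenerate hd, s.pairing'_nondegenerate hd, s.antipodeB,
    s.pairing_eq_pairing' hd, W, ⟨?_, ?_, ?_⟩, fun a m => ?_, D.ev, fun a m => ?_,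
    hΔ.isModuleAlgebra hd h₁ h₂⟩
  · rw [hslice, ← D.rmulV_mul, s.z_mul_w, D.rmulV_one]
  · rw [hslice, ← D.rmulV_mul, s.w_mul_z, D.rmulV_one]
  · rw [h₁]
    exact hΔ.pairing
  · rw [h₂]
    exact fun a => rfl
  · rw [h₃]
    exact s.pairing_antipode hd hprod
  · rw [hΔ.adjointAction_eq hd h₁ h₃]
    exact ⟨_, rfl⟩
  · rw [hΔ.adjointAction_eq hd h₁ h₃]
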